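/- Let $\gamma>0$, $d\in[0,1)$, $\alpha>-d$, and let $$\nu(\mathrm d\theta)=\gamma\,\frac{\Gamma(\alpha+1)}{\Gamma(1-d)\Gamma(\alpha+d)}\,\mathbf 1[0<\theta\le 1]\,\theta^{-1-d}(1-\theta)^{\alpha+d-1}\,\mathrm d\theta$$ be the rate measure of the beta process $\mathrm{BP}(\gamma,\alpha,d)$. Let $h(x\mid\theta)$, $x\in\{0,1,2,\dots\}$, be either the Bernoulli likelihood $h(x\mid\theta)=\mathbf 1[x\le1]\,\theta^x(1-\theta)^{1-x}$ or the negative binomial likelihood $h(x\mid\theta)=\binom{x+s-1}{x}(1-\theta)^s\theta^x$ with an integer $s\ge1$, and put $\pi(\theta)=h(0\mid\theta)$. *Size-biased representation.* For $k,x\ge1$ let $\eta_{kx}=\int h(x\mid\theta)\pi(\theta)^{k-1}\nu(\mathrm d\theta)$ and $\eta_k=\sum_{x\ge1}\eta_{kx}$. The size-biased representation of $\mathrm{BP}(\gamma,\alpha,d)$ for $h$ is $\Theta=\sum_{k\ge1}\sum_{i=1}^{C_k}\theta_{ki}\delta_{\psi_{ki}}$, where $C_k\sim\mathrm{Poisson}(\eta_k)$,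 the mark $z_{ki}\in\{1,2,\dots\}$ equals $x$ with probability $\eta_{kx}/\eta_k$, given $z_{ki}=x$ the weight $\theta_{ki}$ has law $\eta_{kx}^{-1}h(x\mid\theta)\pi(\theta)^{k-1}\nu(\mathrm d\theta)$, the locations $\psi_{ki}$ have a common law $G$, and all these variables are independent except for the stated dependence of $\theta_{ki}$ on $z_{ki}$. *Truncation.* Given $\Theta$, let $x_{nki}\sim h(\cdot\mid\theta_{ki})$ independently, $X_n=\sum_{k\ge1}\sum_{i\le C_k}x_{nki}\delta_{\psi_{ki}}$, and let the data $Y_1,\dots,Y_N$ be conditionally independent with $Y_n\sim f(\cdot\mid X_n)$ for a Markov kernel $f$. In the model truncated at level $K\ge0$, the outer sum runs over $k\le K$ only. Let $\nu_K^+=\sum_{k>K}\sum_{x\ge1}h(x\mid\theta)\pi(\theta)^{k-1}\nu(\mathrm d\theta)$ be the rate measure of the discarded atoms, and $B_{N,K}=\int(1-\pi(\theta)^N)\,\nu_K^+(\mathrm d\theta)$. Write $\psi=\Gamma'/\Gamma$ for the digamma function, read $1/\Gamma(0)$ as $0$, and let $u_K\sim v_K$ mean asymptotic equivalence as $K\to\infty$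 with everything else fixed. Then the following hold for both likelihoods and all $N,K\ge0$, $k\ge1$. * $\nu_0^+=\nu$, $\ \eta_k=\int\pi(\theta)^{k-1}(1-\pi(\theta))\,\nu(\mathrm d\theta)<\infty$ and $B_{N,K}=\sum_{n=1}^N\eta_{K+n}$. * The total variation distance $\tfrac12\|p_{N,\infty}-p_{N,K}\|_1$ between the laws of $(Y_1,\dots,Y_N)$ in the full and in the truncated model is at most $1-e^{-B_{N,K}}$. **Bernoulli likelihood.** 1. $\displaystyle \eta_k=\eta_{k1}=\gamma\,\frac{\Gamma(\alpha+1)}{\Gamma(\alpha+d)}\,\frac{\Gamma(\alpha+d+k-1)}{\Gamma(\alpha+k)}>0$, and $\eta_{kx}=0$ for $x>1$. Hence $z_{ki}=1$ almost surely and $\theta_{ki}\sim\mathrm{Beta}(1-d,\alpha+d+k-1)$. So, up to the marks, the size-biased representation is exactly the construction with independent $C_k\sim\mathrm{Poisson}(\eta_k)$, $\theta_{ki}\sim\mathrm{Beta}(1-d,\alpha+d+k-1)$, $\psi_{ki}\sim G$. For $d=0$ this is the Thibaux–Jordan construction: independent $C_k\sim\mathrm{Poisson}(\gamma\alpha/(\alpha+k-1))$,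 $\theta_{ki}\sim\mathrm{Beta}(1,\alpha+k-1)$, $\psi_{ki}\sim G$. 2. If $d>0$, then $$0\le B_{N,K}=\frac{\gamma}{d}\frac{\Gamma(\alpha+1)}{\Gamma(\alpha+d)}\left(\frac{\Gamma(\alpha+d+K+N)}{\Gamma(\alpha+K+N)}-\frac{\Gamma(\alpha+d+K)}{\Gamma(\alpha+K)}\right)\sim\gamma N\frac{\Gamma(\alpha+1)}{\Gamma(\alpha+d)}K^{d-1}.$$ 3. If $d=0$, then $0\le B_{N,K}=\gamma\alpha\,(\psi(\alpha+N+K)-\psi(\alpha+K))\sim\gamma\alpha NK^{-1}$. **Negative binomial likelihood**, for every integer $s\ge1$. 4. If $d>0$, then $$\eta_k=\frac{\gamma}{d}\frac{\Gamma(\alpha+1)}{\Gamma(\alpha+d)}\left(\frac{\Gamma(\alpha+d+ks)}{\Gamma(\alpha+ks)}-\frac{\Gamma(\alpha+d+(k-1)s)}{\Gamma(\alpha+(k-1)s)}\right)>0,$$ $$0\le B_{N,K}=\frac{\gamma}{d}\frac{\Gamma(\alpha+1)}{\Gamma(\alpha+d)}\left(\frac{\Gamma(\alpha+d+(K+N)s)}{\Gamma(\alpha+(K+N)s)}-\frac{\Gamma(\alpha+d+Ks)}{\Gamma(\alpha+Ks)}\right)\sim\gamma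 Ns^d\frac{\Gamma(\alpha+1)}{\Gamma(\alpha+d)}K^{d-1}.$$ 5. If $\alpha>0$, then the rate $\eta_k$ of $\mathrm{BP}(\gamma,\alpha,0)$ equals $\gamma\alpha\,(\psi(\alpha+ks)-\psi(\alpha+(k-1)s))>0$, and this is also the limit as $d'\downarrow0$ of the rates $\eta_k$ of $\mathrm{BP}(\gamma,\alpha,d')$. If $d=0$, then $0\le B_{N,K}=\gamma\alpha\,(\psi(\alpha+(K+N)s)-\psi(\alpha+Ks))\sim\gamma\alpha NK^{-1}$. -/

import Mathlib

open MeasureTheory ProbabilityTheory Filter Topology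
open scoped ENNReal NNReal

noncomputable section

/-- The rate (Lévy) measure of the beta process with mass `γ`, concentration `α`, discount `d`. -/
def betaProcessRate (γ α d : ℝ) : Measure ℝ :=
  (volume.restrict (Set.Ioc 0 1)).withDensity fun t =>
    ENNReal.ofReal (γ * (Real.Gamma (α + 1) / (Real.Gamma (1 - d) * Real.Gamma (α + d)))
      * t ^ (-1 - d) * (1 - t) ^ (α + d - 1))

/-- Bernoulli likelihood `h(x | t)`. -/
def bernoulliLik (x : ℕ) (t : ℝ) : ℝ := if x ≤ 1 then t ^ x * (1 - t) ^ (1 - x) else 0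

/-- Negative binomial likelihood `h(x | t)` with `s` failures (`s ≥ 1`). -/
def negBinLik (s x : ℕ) (t : ℝ) : ℝ := ((x + s - 1).choose x : ℝ) * (1 - t) ^ s * t ^ x

/-- The digamma function on the reals. -/
def realDigamma (x : ℝ) : ℝ := logDeriv Real.Gamma x

/-! ### Size-biased representation for a rate measure `ν` and a likelihood `h` on `ℕ`.
Throughout, `π(t) = h 0 t` is the probability of a zero observation and the rounds of the
representation are `k = 1, 2, …`. -/

/-- The intensity `h(x | t) π(t)^(k-1) ν(dt)` of the weights of round `k` with first value `x`. -/
def sbIntensity (ν : Measure ℝ) (h : ℕ → ℝ → ℝ) (k x : ℕ) : Measure ℝ :=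
  ν.withDensity fun t => ENNReal.ofReal (h x t * h 0 t ^ (k - 1))

/-- `η_{kx} = ∫ h(x | t) π(t)^(k-1) ν(dt)`. -/
def sbRateAt (ν : Measure ℝ) (h : ℕ → ℝ → ℝ) (k x : ℕ) : ℝ≥0∞ :=
  ∫⁻ t, ENNReal.ofReal (h x t * h 0 t ^ (k - 1)) ∂ν

/-- `η_k = ∑_{x ≥ 1} η_{kx}`. -/
def sbRate (ν : Measure ℝ) (h : ℕ → ℝ → ℝ) (k : ℕ) : ℝ≥0∞ :=
  ∑' x : ℕ, sbRateAt ν h k (x + 1)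

/-- The law `η_{kx}⁻¹ h(x | t) π(t)^(k-1) ν(dt)` of a round `k` weight given its mark `x`. -/
def sbWeightLaw (ν : Measure ℝ) (h : ℕ → ℝ → ℝ) (k x : ℕ) : Measure ℝ :=
  (sbRateAt ν h k x)⁻¹ • sbIntensity ν h k x

/-- The joint law of (mark, weight) in round `k`: the mark is `x ≥ 1` with probability
`η_{kx} / η_k`, and given the mark `x` the weight has law `sbWeightLaw ν h k x`. -/
def sbMarkWeightLaw (ν : Measure ℝ) (h : ℕ → ℝ → ℝ) (k : ℕ) : Measure (ℕ × ℝ) :=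
  Measure.sum fun x : ℕ =>
    (sbRateAt ν h k (x + 1) / sbRate ν h k) •
      (sbWeightLaw ν h k (x + 1)).map (fun t => (x + 1, t))

section Representations

variable {Ω Ψ : Type*} [MeasurableSpace Ω] [MeasurableSpace Ψ]

/-- `(C, z, θ, ψ)` is a size-biased representation `∑_k ∑_{i < C_k} θ_{ki} δ_{ψ_{ki}}` for the rate
measure `ν`, the likelihood `h` and the base distribution `G` of the locations: `C_k` is Poisson
with mean `η_k`, the marks and weights `(z_{ki}, θ_{ki})` have law `sbMarkWeightLaw ν h k`, the
locations `ψ_{ki}` have law `G`, and everything is independent, except for `z_{ki}` and `θ_{ki}`.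
Index `j : ℕ` stands for round `k = j + 1`; only the atoms with `i < C j` are present. -/
structure IsSizeBiasedRep (ν : Measure ℝ) (h : ℕ → ℝ → ℝ) (G : Measure Ψ) (P : Measure Ω)
    (C : ℕ → Ω → ℕ) (z : ℕ → ℕ → Ω → ℕ) (θ : ℕ → ℕ → Ω → ℝ) (ψ : ℕ → ℕ → Ω → Ψ) : Prop where
  measurable_count : ∀ j, Measurable (C j)
  measurable_mark : ∀ j i, Measurable (z j i)
  measurable_weight : ∀ j i, Measurable (θ j i)
  measurable_loc : ∀ j i, Measurable (ψ j i)
  law_count : ∀ j, P.map (C j) = poissonMeasure (sbRate ν h (j + 1)).toNNReal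
  law_atom : ∀ j i, P.map (fun ω => ((z j i ω, θ j i ω), ψ j i ω)) =
    (sbMarkWeightLaw ν h (j + 1)).prod G
  indep_count : iIndepFun C P
  indep_atom : iIndepFun
    (fun (p : ℕ × ℕ) ω => ((z p.1 p.2 ω, θ p.1 p.2 ω), ψ p.1 p.2 ω)) P
  indep_count_atom : IndepFun (fun ω j => C j ω)
    (fun ω (p : ℕ × ℕ) => ((z p.1 p.2 ω, θ p.1 p.2 ω), ψ p.1 p.2 ω)) P

/-- `(C, θ, ψ)` is built in rounds `k = j + 1`, without marks: `C_k` is Poisson with mean `r k`,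
each weight of round `k` has law `W k`, each location has law `G`, and all are independent. -/
structure IsPoissonRounds (r : ℕ → ℝ≥0) (W : ℕ → Measure ℝ) (G : Measure Ψ) (P : Measure Ω)
    (C : ℕ → Ω → ℕ) (θ : ℕ → ℕ → Ω → ℝ) (ψ : ℕ → ℕ → Ω → Ψ) : Prop where
  measurable_count : ∀ j, Measurable (C j)
  measurable_weight : ∀ j i, Measurable (θ j i)
  measurable_loc : ∀ j i, Measurable (ψ j i)
  law_count : ∀ j, P.map (C j) = poissonMeasure (r (j + 1))
  law_atom : ∀ j i, P.map (fun ω => (θ j i ω, ψ j i ω)) = (W (j + 1)).prod G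
  indep_count : iIndepFun C P
  indep_atom : iIndepFun (fun (p : ℕ × ℕ) ω => (θ p.1 p.2 ω, ψ p.1 p.2 ω)) P
  indep_count_atom : IndepFun (fun ω j => C j ω)
    (fun ω (p : ℕ × ℕ) => (θ p.1 p.2 ω, ψ p.1 p.2 ω)) P

/-- The Thibaux–Jordan construction of the beta process with mass `γ` and concentration `c`:
round `k` has a Poisson number, with mean `γ c / (c + k - 1)`, of atoms with
`Beta(1, c + k - 1)` weights. -/
def IsThibauxJordan (γ c : ℝ) (G : Measure Ψ) (P : Measure Ω)
    (C : ℕ → Ω → ℕ) (θ : ℕ → ℕ → Ω → ℝ) (ψ : ℕ → ℕ → Ω → Ψ) : Prop :=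
  IsPoissonRounds (fun k => (γ * c / (c + k - 1)).toNNReal)
    (fun k => betaMeasure 1 (c + k - 1)) G P C θ ψ

/-- Given the representation, the trait counts `x n j i` (observation `n`, atom `i` of round
`j + 1`) are independent, with `x n j i` distributed as `h(· | θ j i)`. -/
structure IsLikelihoodField (h : ℕ → ℝ → ℝ) (P : Measure Ω)
    (C : ℕ → Ω → ℕ) (z : ℕ → ℕ → Ω → ℕ) (θ : ℕ → ℕ → Ω → ℝ) (ψ : ℕ → ℕ → Ω → Ψ)
    (x : ℕ → ℕ → ℕ → Ω → ℕ) : Prop where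
  measurable_obs : ∀ n j i, Measurable (x n j i)
  cond_law : ∀ S : Set ((ℕ → ℕ) × (ℕ × ℕ → (ℕ × ℝ) × Ψ)), MeasurableSet S →
    ∀ (F : Finset (ℕ × ℕ × ℕ)) (v : ℕ × ℕ × ℕ → ℕ),
      P ({ω | ((fun j => C j ω), fun p : ℕ × ℕ => ((z p.1 p.2 ω, θ p.1 p.2 ω), ψ p.1 p.2 ω)) ∈ S} ∩
          {ω | ∀ p ∈ F, x p.1 p.2.1 p.2.2 ω = v p}) =
        ∫⁻ ω in {ω | ((fun j => C j ω),
            fun p : ℕ × ℕ => ((z p.1 p.2 ω, θ p.1 p.2 ω), ψ p.1 p.2 ω)) ∈ S},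
          ∏ p ∈ F, ENNReal.ofReal (h (v p) (θ p.2.1 p.2.2 ω)) ∂P

/-- The part `∑_{i < C_k} x_{ki} δ_{ψ_{ki}}` of an observation that comes from round `k = j + 1`. -/
def roundObs (C : ℕ → Ω → ℕ) (ψ : ℕ → ℕ → Ω → Ψ) (x : ℕ → ℕ → Ω → ℕ) (j : ℕ) (ω : Ω) :
    Measure Ψ :=
  ∑ i ∈ Finset.range (C j ω), (x j i ω : ℝ≥0∞) • Measure.dirac (ψ j i ω)

/-- An observation of the likelihood process based on the whole representation. -/
def fullObs (C : ℕ → Ω → ℕ) (ψ : ℕ → ℕ → Ω → Ψ) (x : ℕ → ℕ → Ω → ℕ) (ω : Ω) : Measure Ψ :=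
  Measure.sum fun j => roundObs C ψ x j ω

/-- An observation of the likelihood process based on the first `K` rounds only. -/
def truncObs (C : ℕ → Ω → ℕ) (ψ : ℕ → ℕ → Ω → Ψ) (x : ℕ → ℕ → Ω → ℕ) (K : ℕ) (ω : Ω) :
    Measure Ψ :=
  ∑ j ∈ Finset.range K, roundObs C ψ x j ω

/-- The probability that `(Y_1, …, Y_N) ∈ A`, where given the random measures `X_1, …, X_N` the
data `Y_n` are independent with `Y_n ∼ f(· | X_n)`. -/
def dataProb {𝒴 : Type*} [MeasurableSpace 𝒴] (P : Measure Ω) (f : Kernel (Measure Ψ) 𝒴)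
    {N : ℕ} (X : Fin N → Ω → Measure Ψ) (A : Set (Fin N → 𝒴)) : ℝ≥0∞ :=
  ∫⁻ ω, Measure.pi (fun n => f (X n ω)) A ∂P

end Representations

/-- The rate measure `∑_{k > K} ∑_{x ≥ 1} h(x | t) π(t)^(k-1) ν(dt)` of the atoms that remain after
the first `K` rounds. -/
def sbTail (ν : Measure ℝ) (h : ℕ → ℝ → ℝ) (K : ℕ) : Measure ℝ :=
  Measure.sum fun j : ℕ => Measure.sum fun x : ℕ => sbIntensity ν h (K + 1 + j) (x + 1)

/-- The truncation bound `B_{N,K} = ∫ (1 - π(t)^N) dν_K^+`, `ν_K^+` the tail rate measure. -/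
def sbTruncBound (ν : Measure ℝ) (h : ℕ → ℝ → ℝ) (N K : ℕ) : ℝ≥0∞ :=
  ∫⁻ t, ENNReal.ofReal (1 - h 0 t ^ N) ∂(sbTail ν h K)

end

/-! Both likelihoods satisfy π(t) = (1 - t)^s on (0, 1), with s = 1 in the Bernoulli case, and
almost all of the statement depends on h only through π. Summing h(x | t) over x ≥ 1 gives 1 - π,
and a geometric series over the rounds then shows that the tail measure is π^K ν
(`sbTail_eq_withDensity`). Hence B_{N,K} = ∫ π^K (1 - π^N) dν, which splits into the rates of the
next N rounds.

For the beta process, 1 - (1 - t)^M = t ∑_{j<M} (1 - t)^j reduces every rate and bound to a finite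
sum of beta integrals `betaRate` n = ∫ t (1 - t)^n dν. The recurrence of Γ, or of the digamma
function when d = 0, makes these sums telescope into the closed forms. The asymptotics come from the
same sums: each of the N s terms is a Gamma ratio of order K^(d-1), so no difference of large
quantities has to be estimated.

The total variation bound is a coupling. If none of the first N observations sees an atom beyond
round K, the full and truncated observations agree. Given the counts the atoms are independent, so
the Poisson generating function gives round k the no-atom probability exp(-∫ (1 - π^N) π^(k-1) (1 -
π) dν). The exponents over k > K sum to at most B_{N,K} (`exp_neg_le_measure_noAtoms`).

Under the Bernoulli likelihood only the mark 1 has positive rate, so marks can be attached or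
forgotten freely; this gives the explicit construction and, at d = 0, that of Thibaux and Jordan. -/

/-- `h` is a family of likelihoods on `ℕ`, parametrized by `t ∈ (0, 1)`, for which a nonzero
observation has positive probability. -/
structure IsNatLikelihood (h : ℕ → ℝ → ℝ) : Prop where
  measurable : ∀ x, Measurable (h x)
  nonneg : ∀ x, ∀ t ∈ Set.Ioo (0 : ℝ) 1, 0 ≤ h x t
  hasSum : ∀ t ∈ Set.Ioo (0 : ℝ) 1, HasSum (fun x => h x t) 1
  zero_lt_one : ∀ t ∈ Set.Ioo (0 : ℝ) 1, h 0 t < 1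

theorem isNatLikelihood_bernoulliLik : IsNatLikelihood bernoulliLik where
  measurable x := by
    unfold bernoulliLik
    by_cases hx : x ≤ 1 <;> simp only [hx, if_true, if_false] <;> fun_prop
  nonneg x t ht := by
    have h1 : 0 < t := ht.1
    have h2 : 0 < 1 - t := sub_pos.2 ht.2
    unfold bernoulliLik
    split_ifs <;> positivity
  hasSum t _ := by
    have : HasSum (fun x => bernoulliLik x t) (∑ x ∈ Finset.range 2, bernoulliLik x t) := by
      refine hasSum_sum_of_ne_finset_zero fun x hx => ?_
      have : ¬ x ≤ 1 := by simpa [Nat.lt_succ_iff] using hx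
      simp [bernoulliLik, this]
    simpa [Finset.sum_range_succ, bernoulliLik] using this
  zero_lt_one t ht := by simpa [bernoulliLik] using ht.1

theorem bernoulliLik_zero (t : ℝ) : bernoulliLik 0 t = (1 - t) ^ 1 := by simp [bernoulliLik]

theorem negBinLik_zero (s : ℕ) (t : ℝ) : negBinLik s 0 t = (1 - t) ^ s := by simp [negBinLik]

theorem isNatLikelihood_negBinLik {s : ℕ} (hs : 1 ≤ s) : IsNatLikelihood (negBinLik s) where
  measurable x := by unfold negBinLik; fun_prop
  nonneg x t ht := by
    have h1 : 0 < t := ht.1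
    have h2 : 0 < 1 - t := sub_pos.2 ht.2
    unfold negBinLik
    positivity
  hasSum t ht := by
    have h2 : 0 < 1 - t := sub_pos.2 ht.2
    have hn : ‖t‖ < 1 := by rw [Real.norm_of_nonneg ht.1.le]; exact ht.2
    -- The negative binomial series ∑ C(x+s-1, s-1) t^x = (1 - t)^(-s) supplies the normalization.
    have := (hasSum_choose_mul_geometric_of_norm_lt_one (s - 1) hn).mul_left ((1 - t) ^ s)
    rw [Nat.sub_add_cancel hs, mul_one_div_cancel (by positivity)] at this
    refine this.congr_fun fun x => ?_
    rw [negBinLik, Nat.add_sub_assoc hs, Nat.choose_symm_add]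
    ring
  zero_lt_one t ht := by
    rw [negBinLik_zero]
    exact pow_lt_one₀ (sub_nonneg.2 ht.2.le) (by linarith [ht.1]) (by omega)

/-! ### Summation over marks and rounds for a general likelihood. -/

section General

variable {ν : Measure ℝ} {h : ℕ → ℝ → ℝ}

theorem IsNatLikelihood.tsum_succ (hh : IsNatLikelihood h) {t : ℝ} (ht : t ∈ Set.Ioo (0 : ℝ) 1) :
    ∑' x, ENNReal.ofReal (h (x + 1) t) = ENNReal.ofReal (1 - h 0 t) := by
  have h1 : HasSum (fun x => h (x + 1) t) (1 - h 0 t) := by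
    simpa using (hasSum_nat_add_iff' 1).2 (hh.hasSum t ht)
  rw [← h1.tsum_eq, ENNReal.ofReal_tsum_of_nonneg (fun x => hh.nonneg _ _ ht) h1.summable]

theorem IsNatLikelihood.tsum_succ_mul (hh : IsNatLikelihood h) {t : ℝ}
    (ht : t ∈ Set.Ioo (0 : ℝ) 1) (m : ℕ) :
    ∑' x, ENNReal.ofReal (h (x + 1) t * h 0 t ^ m) =
      ENNReal.ofReal (h 0 t ^ m * (1 - h 0 t)) := by
  have h0 := hh.nonneg 0 t ht
  rw [ENNReal.ofReal_mul (by positivity), ← hh.tsum_succ ht, ← ENNReal.tsum_mul_left]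
  refine tsum_congr fun x => ?_
  rw [mul_comm, ENNReal.ofReal_mul (by positivity)]

theorem sbRate_eq_lintegral (hh : IsNatLikelihood h) (hν : ∀ᵐ t ∂ν, t ∈ Set.Ioo (0 : ℝ) 1)
    (k : ℕ) :
    sbRate ν h k = ∫⁻ t, ENNReal.ofReal (h 0 t ^ (k - 1) * (1 - h 0 t)) ∂ν := by
  have hm := hh.measurable
  simp only [sbRate, sbRateAt]
  rw [← lintegral_tsum fun x => by fun_prop]
  refine lintegral_congr_ae ?_
  filter_upwards [hν] with t ht
  exact hh.tsum_succ_mul ht _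

/-- Summing over marks leaves π^(K+j) (1 - π) for round K + 1 + j; the geometric series over j
cancels the factor 1 - π, which is nonzero almost everywhere. -/
theorem sbTail_eq_withDensity (hh : IsNatLikelihood h) (hν : ∀ᵐ t ∂ν, t ∈ Set.Ioo (0 : ℝ) 1)
    (K : ℕ) : sbTail ν h K = ν.withDensity fun t => ENNReal.ofReal (h 0 t ^ K) := by
  have hm := hh.measurable
  have h1 (j : ℕ) : (Measure.sum fun x : ℕ => sbIntensity ν h (K + 1 + j) (x + 1)) =
      ν.withDensity (∑' x : ℕ, fun t => ENNReal.ofReal (h (x + 1) t * h 0 t ^ (K + j))) := by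
    rw [withDensity_tsum fun x => by fun_prop]
    simp only [sbIntensity, show K + 1 + j - 1 = K + j by omega]
  simp only [sbTail, h1]
  rw [← withDensity_tsum fun j => Measurable.tsum' fun x => by fun_prop]
  refine withDensity_congr_ae ?_
  filter_upwards [hν] with t ht
  have h0 := hh.nonneg 0 t ht
  have hlt := hh.zero_lt_one t ht
  have h2 (j : ℕ) : (∑' x : ℕ, fun t => ENNReal.ofReal (h (x + 1) t * h 0 t ^ (K + j))) t =
      ENNReal.ofReal (h 0 t ^ K * (1 - h 0 t) * h 0 t ^ j) := by
    rw [ENNReal.tsum_apply, hh.tsum_succ_mul ht]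
    ring_nf
  rw [ENNReal.tsum_apply]
  simp only [h2]
  rw [← ENNReal.ofReal_tsum_of_nonneg, tsum_mul_left, tsum_geometric_of_lt_one h0 hlt,
    mul_inv_cancel_right₀ (by linarith)]
  · intro j
    have : 0 ≤ 1 - h 0 t := by linarith
    positivity
  · exact (summable_geometric_of_lt_one h0 hlt).mul_left _

theorem sbTail_zero (hh : IsNatLikelihood h) (hν : ∀ᵐ t ∂ν, t ∈ Set.Ioo (0 : ℝ) 1) :
    sbTail ν h 0 = ν := by
  simp [sbTail_eq_withDensity hh hν]

theorem sbTruncBound_eq_lintegral (hh : IsNatLikelihood h)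
    (hν : ∀ᵐ t ∂ν, t ∈ Set.Ioo (0 : ℝ) 1) (N K : ℕ) :
    sbTruncBound ν h N K = ∫⁻ t, ENNReal.ofReal (h 0 t ^ K * (1 - h 0 t ^ N)) ∂ν := by
  have hm := hh.measurable
  rw [sbTruncBound, sbTail_eq_withDensity hh hν,
    lintegral_withDensity_eq_lintegral_mul _ (by fun_prop) (by fun_prop)]
  refine lintegral_congr_ae ?_
  filter_upwards [hν] with t ht
  have h0 := hh.nonneg 0 t ht
  rw [Pi.mul_apply, ENNReal.ofReal_mul (by positivity)]

/-- Pointwise, π^K (1 - π^N) = ∑_{n=1}^N π^(K+n-1) (1 - π). -/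
theorem sbTruncBound_eq_sum (hh : IsNatLikelihood h)
    (hν : ∀ᵐ t ∂ν, t ∈ Set.Ioo (0 : ℝ) 1) (N K : ℕ) :
    sbTruncBound ν h N K = ∑ n ∈ Finset.Icc 1 N, sbRate ν h (K + n) := by
  have hm := hh.measurable
  simp only [sbTruncBound_eq_lintegral hh hν, sbRate_eq_lintegral hh hν]
  rw [← lintegral_finsetSum _ fun n _ => by fun_prop]
  refine lintegral_congr_ae ?_
  filter_upwards [hν] with t ht
  have h0 := hh.nonneg 0 t ht
  have hlt := hh.zero_lt_one t ht
  rw [← ENNReal.ofReal_sum_of_nonneg fun n _ => mul_nonneg (by positivity) (by linarith)]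
  congr 1
  rw [← Finset.Ico_succ_right_eq_Icc, Finset.sum_Ico_eq_sum_range, ← mul_neg_geom_sum]
  simp only [Nat.succ_eq_succ, Nat.add_one_sub_one, Nat.succ_eq_add_one, Finset.mul_sum]
  refine Finset.sum_congr rfl fun j _ => ?_
  rw [show K + (1 + j) - 1 = K + j by omega]
  ring

end General

/-! ### Beta integrals against the beta process rate measure. -/

theorem ae_mem_Ioo_betaProcessRate (γ α d : ℝ) :
    ∀ᵐ t ∂(betaProcessRate γ α d), t ∈ Set.Ioo (0 : ℝ) 1 := by
  rw [betaProcessRate, ← Measure.restrict_congr_set Ioo_ae_eq_Ioc]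
  exact (withDensity_absolutelyContinuous _ _).ae_le (ae_restrict_mem measurableSet_Ioo)

/-- The rate `∫ (1 - t)^n t ν(dt)` of the beta process rate measure `ν`, as a closed form. -/
noncomputable def betaRate (γ α d : ℝ) (n : ℕ) : ℝ :=
  γ * (Real.Gamma (α + 1) / Real.Gamma (α + d)) *
    (Real.Gamma (α + d + n) / Real.Gamma (α + 1 + n))

section Rate

variable {γ α d : ℝ}

theorem betaRate_pos (hγ : 0 < γ) (hd1 : d < 1) (hα : -d < α) (n : ℕ) :
    0 < betaRate γ α d n := by
  have hn : (0 : ℝ) ≤ n := n.cast_nonneg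
  have h1 := Real.Gamma_pos_of_pos (show 0 < α + 1 by linarith)
  have h2 := Real.Gamma_pos_of_pos (show 0 < α + d by linarith)
  have h3 := Real.Gamma_pos_of_pos (show 0 < α + d + n by linarith)
  have h4 := Real.Gamma_pos_of_pos (show 0 < α + 1 + n by linarith)
  unfold betaRate
  positivity

/-- The factor t raises the exponent -1 - d to -d, which is integrable at 0: the infinite measure ν
becomes a multiple of a beta law, and the quotient of normalizing constants is `betaRate`. -/
theorem betaProcessRate_withDensity (hγ : 0 < γ) (hd1 : d < 1) (hα : -d < α) (n : ℕ) :
    (betaProcessRate γ α d).withDensity (fun t => ENNReal.ofReal (t * (1 - t) ^ n)) =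
      ENNReal.ofReal (betaRate γ α d n) • betaMeasure (1 - d) (α + d + n) := by
  have hn : (0 : ℝ) ≤ n := n.cast_nonneg
  have h1 := Real.Gamma_pos_of_pos (show 0 < α + 1 by linarith)
  have h2 := Real.Gamma_pos_of_pos (show 0 < α + d by linarith)
  have h3 := Real.Gamma_pos_of_pos (show 0 < α + d + n by linarith)
  have h4 := Real.Gamma_pos_of_pos (show 0 < α + 1 + n by linarith)
  have h5 := Real.Gamma_pos_of_pos (show 0 < 1 - d by linarith)
  have hmeas : Measurable (betaPDF (1 - d) (α + d + n)) := by unfold betaPDF; fun_prop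
  rw [betaProcessRate, betaMeasure, ← withDensity_smul _ hmeas,
    ← Measure.restrict_congr_set Ioo_ae_eq_Ioc, ← withDensity_mul _ (by fun_prop) (by fun_prop),
    ← withDensity_indicator measurableSet_Ioo]
  congr 1
  funext t
  by_cases ht : t ∈ Set.Ioo (0 : ℝ) 1
  · have ht0 : 0 < t := ht.1
    have ht1 : 0 < 1 - t := sub_pos.2 ht.2
    have e1 : t ^ (1 - d - 1) = t ^ (-1 - d) * t := by
      rw [← Real.rpow_add_one ht0.ne']; ring_nf
    have e2 : (1 - t) ^ (α + d + n - 1) = (1 - t) ^ (α + d - 1) * (1 - t) ^ n := by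
      rw [← Real.rpow_add_natCast ht1.ne']; ring_nf
    have e3 : 1 - d + (α + d + n) = α + 1 + n := by ring
    rw [Set.indicator_of_mem ht, Pi.mul_apply, Pi.smul_apply, smul_eq_mul,
      betaPDF_of_pos_lt_one ht.1 ht.2, ← ENNReal.ofReal_mul (by positivity),
      ← ENNReal.ofReal_mul (betaRate_pos hγ hd1 hα n).le, e1, e2, beta, e3, betaRate]
    congr 1
    field_simp
  · rw [Set.indicator_of_notMem ht, Pi.smul_apply, betaPDF, betaPDFReal,
      if_neg (by simpa using ht)]
    simp

theorem lintegral_betaProcessRate_mul_pow (hγ : 0 < γ) (hd1 : d < 1) (hα : -d < α) (n : ℕ) :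
    ∫⁻ t, ENNReal.ofReal (t * (1 - t) ^ n) ∂(betaProcessRate γ α d) =
      ENNReal.ofReal (betaRate γ α d n) := by
  have hn : (0 : ℝ) ≤ n := n.cast_nonneg
  have := isProbabilityMeasureBeta (show 0 < 1 - d by linarith) (show 0 < α + d + n by linarith)
  rw [← setLIntegral_univ, ← withDensity_apply _ MeasurableSet.univ,
    betaProcessRate_withDensity hγ hd1 hα]
  simp

/-- The factorization 1 - (1 - t)^M = t ∑_{j<M} (1 - t)^j turns the integrand into a sum of beta
integrands. -/
theorem lintegral_betaProcessRate_pow_mul_one_sub_pow (hγ : 0 < γ) (hd1 : d < 1) (hα : -d < α)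
    (n M : ℕ) :
    ∫⁻ t, ENNReal.ofReal ((1 - t) ^ n * (1 - (1 - t) ^ M)) ∂(betaProcessRate γ α d) =
      ENNReal.ofReal (∑ j ∈ Finset.range M, betaRate γ α d (n + j)) := by
  rw [ENNReal.ofReal_sum_of_nonneg fun j _ => (betaRate_pos hγ hd1 hα _).le]
  simp only [← lintegral_betaProcessRate_mul_pow hγ hd1 hα]
  rw [← lintegral_finsetSum _ fun n _ => by fun_prop]
  refine lintegral_congr_ae ?_
  filter_upwards [ae_mem_Ioo_betaProcessRate γ α d] with t ht
  have ht0 : 0 < t := ht.1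
  have ht1 : 0 < 1 - t := sub_pos.2 ht.2
  rw [← ENNReal.ofReal_sum_of_nonneg fun n _ => by positivity, ← mul_neg_geom_sum, sub_sub_cancel,
    Finset.mul_sum, Finset.mul_sum]
  congr 1
  exact Finset.sum_congr rfl fun j _ => by ring

variable {h : ℕ → ℝ → ℝ} {s : ℕ}

theorem sbRate_betaProcessRate (hh : IsNatLikelihood h) (h0 : ∀ t, h 0 t = (1 - t) ^ s)
    (hγ : 0 < γ) (hd1 : d < 1) (hα : -d < α) (k : ℕ) :
    sbRate (betaProcessRate γ α d) h k =
      ENNReal.ofReal (∑ j ∈ Finset.range s, betaRate γ α d ((k - 1) * s + j)) := by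
  rw [sbRate_eq_lintegral hh (ae_mem_Ioo_betaProcessRate γ α d),
    ← lintegral_betaProcessRate_pow_mul_one_sub_pow hγ hd1 hα]
  simp only [h0, ← pow_mul, mul_comm s]

theorem sbTruncBound_betaProcessRate (hh : IsNatLikelihood h) (h0 : ∀ t, h 0 t = (1 - t) ^ s)
    (hγ : 0 < γ) (hd1 : d < 1) (hα : -d < α) (N K : ℕ) :
    sbTruncBound (betaProcessRate γ α d) h N K =
      ENNReal.ofReal (∑ j ∈ Finset.range (N * s), betaRate γ α d (K * s + j)) := by
  rw [sbTruncBound_eq_lintegral hh (ae_mem_Ioo_betaProcessRate γ α d),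
    ← lintegral_betaProcessRate_pow_mul_one_sub_pow hγ hd1 hα]
  simp only [h0, ← pow_mul, mul_comm s]

/-! ### Closed forms of partial sums of the rates -/

/-- The ratio Γ(c + d) / Γ(c) has forward difference d Γ(c + d) / Γ(c + 1) in c, so the sum
telescopes. -/
theorem sum_betaRate_of_pos (hd : 0 < d) (hd1 : d < 1) (hα : -d < α) (n M : ℕ) :
    ∑ j ∈ Finset.range M, betaRate γ α d (n + j) =
      γ / d * (Real.Gamma (α + 1) / Real.Gamma (α + d)) *
        (Real.Gamma (α + d + (n + M)) / Real.Gamma (α + (n + M)) -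
          Real.Gamma (α + d + n) / Real.Gamma (α + n)) := by
  induction M with
  | zero => simp
  | succ M ih =>
    set c : ℝ := α + (n + M) with hc
    have hnM : (0 : ℝ) ≤ n + M := by positivity
    have h1 : 0 < c + d := by linarith
    have h2 := Real.Gamma_pos_of_pos (show 0 < c + 1 by linarith)
    have key : d * (Real.Gamma (c + d) / Real.Gamma (c + 1)) =
        Real.Gamma (c + d + 1) / Real.Gamma (c + 1) - Real.Gamma (c + d) / Real.Gamma c := by
      rw [Real.Gamma_add_one h1.ne']
      -- For n + M = 0 the point c = α may be zero or negative. At c = 0 the values Γ(0) = 0 and x /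
      -- 0 = 0 realize the convention 1/Γ(0) = 0; otherwise c > -1 and Γ(c) ≠ 0 follows from Γ(c +
      -- 1) > 0.
      by_cases h0 : c = 0
      · simp [h0]
      · have h3 := Real.Gamma_add_one h0
        have h4 : Real.Gamma c ≠ 0 := fun h => by rw [h3, h, mul_zero] at h2; exact h2.ne rfl
        rw [h3]
        field_simp
        ring
    rw [Finset.sum_range_succ, ih, betaRate]
    push_cast
    rw [show α + d + (n + (M + 1)) = c + d + 1 by rw [hc]; ring,
      show α + (n + (M + 1 : ℝ)) = c + 1 by rw [hc]; ring,
      show α + d + (n + M) = c + d by rw [hc]; ring,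
      show α + 1 + (n + M) = c + 1 by rw [hc]; ring]
    have : γ * (Real.Gamma (α + 1) / Real.Gamma (α + d)) *
          (Real.Gamma (c + d) / Real.Gamma (c + 1)) =
        γ / d * (Real.Gamma (α + 1) / Real.Gamma (α + d)) *
          (d * (Real.Gamma (c + d) / Real.Gamma (c + 1))) := by
      field_simp
    rw [this, key]
    ring

/-- Logarithmic derivative of Γ(y + 1) = y Γ(y), an identity that holds near x. -/
theorem realDigamma_add_one {x : ℝ} (hx : 0 < x) : realDigamma (x + 1) = realDigamma x + 1 / x := by
  have hd : ∀ y : ℝ, 0 < y → DifferentiableAt ℝ Real.Gamma y := fun y hy =>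
    Real.differentiableAt_Gamma fun m => by have := (Nat.cast_nonneg m : (0 : ℝ) ≤ m); linarith
  have h1 : (fun y => Real.Gamma (y + 1)) =ᶠ[𝓝 x] fun y => y * Real.Gamma y := by
    filter_upwards [eventually_ne_nhds hx.ne'] with y hy using Real.Gamma_add_one hy
  have h2 : logDeriv (fun y => Real.Gamma (y + 1)) x = realDigamma (x + 1) := by
    rw [realDigamma, logDeriv_apply, logDeriv_apply, deriv_comp_add_const]
  rw [← h2, logDeriv_apply, h1.deriv_eq, h1.eq_of_nhds, ← logDeriv_apply (fun y => y * _),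
    logDeriv_mul _ hx.ne' (Real.Gamma_pos_of_pos hx).ne' differentiableAt_fun_id (hd x hx)]
  simp [realDigamma, logDeriv_apply, add_comm]

theorem betaRate_zero (hα : 0 < α) (n : ℕ) : betaRate γ α 0 n = γ * α / (α + n) := by
  have hn : 0 < α + n := by positivity
  have h1 := Real.Gamma_pos_of_pos hα
  have h2 := Real.Gamma_pos_of_pos hn
  rw [betaRate, add_zero, show α + 1 + n = α + n + 1 by ring, Real.Gamma_add_one hα.ne',
    Real.Gamma_add_one hn.ne']
  field_simp

theorem sum_betaRate_zero (hα : 0 < α) (n M : ℕ) :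
    ∑ j ∈ Finset.range M, betaRate γ α 0 (n + j) =
      γ * α * (realDigamma (α + (n + M)) - realDigamma (α + n)) := by
  induction M with
  | zero => simp
  | succ M ih =>
    rw [Finset.sum_range_succ, ih, betaRate_zero hα]
    push_cast
    rw [show α + (n + (M + 1 : ℝ)) = α + (n + M) + 1 by ring,
      realDigamma_add_one (by positivity)]
    ring

theorem tendsto_betaRate_zero (hα : 0 < α) (n : ℕ) :
    Tendsto (fun δ => betaRate γ α δ n) (𝓝 0) (𝓝 (betaRate γ α 0 n)) := by
  have hd : ∀ y : ℝ, 0 < y → ContinuousAt Real.Gamma y := fun y hy =>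
    (Real.differentiableAt_Gamma fun m => by
      have := (Nat.cast_nonneg m : (0 : ℝ) ≤ m); linarith).continuousAt
  have h1 : ContinuousAt (fun δ => Real.Gamma (α + δ)) 0 :=
    ContinuousAt.comp (g := Real.Gamma) (hd _ (by simpa)) (by fun_prop)
  have h2 : ContinuousAt (fun δ => Real.Gamma (α + δ + n)) 0 :=
    ContinuousAt.comp (g := Real.Gamma) (hd _ (by positivity)) (by fun_prop)
  have h3 : Real.Gamma (α + 0) ≠ 0 := (Real.Gamma_pos_of_pos (by simpa)).ne'
  unfold betaRate
  exact ((continuousAt_const.mul (continuousAt_const.div h1 h3)).mul (h2.div_const _)).tendsto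

/-! ### Asymptotics -/

theorem Gamma_add_natCast_eq_prod {a : ℝ} (ha : 0 < a) (n : ℕ) :
    Real.Gamma (a + n) = Real.Gamma a * ∏ j ∈ Finset.range n, (a + j) := by
  induction n with
  | zero => simp
  | succ n ih =>
    rw [Finset.prod_range_succ, ← mul_assoc, ← ih, Nat.cast_succ, ← add_assoc,
      Real.Gamma_add_one (by positivity), mul_comm]

/-- Euler's product limit for Γ(c) says that Γ(c + n) (c + n) is asymptotic to n^c n!; dividing the
cases c = a and c = b cancels n!. -/
theorem tendsto_Gamma_add_natCast_div {a b : ℝ} (ha : 0 < a) (hb : 0 < b) :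
    Tendsto (fun n : ℕ => Real.Gamma (a + n) / Real.Gamma (b + n) * (n : ℝ) ^ (b - a))
      atTop (𝓝 1) := by
  have key {c : ℝ} (hc : 0 < c) : Tendsto (fun n : ℕ =>
      Real.Gamma (c + n) * (c + n) / ((n : ℝ) ^ c * n.factorial)) atTop (𝓝 1) := by
    have h1 := (tendsto_const_nhds (x := Real.Gamma c)).div (Real.GammaSeq_tendsto_Gamma c)
      (Real.Gamma_pos_of_pos hc).ne'
    rw [div_self (Real.Gamma_pos_of_pos hc).ne'] at h1
    refine h1.congr fun n => ?_
    rw [Pi.div_apply, Real.GammaSeq, Gamma_add_natCast_eq_prod hc, Finset.prod_range_succ, div_div_eq_mul_div]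
    ring
  -- Euler's product has n + 1 factors, one more than Γ(c + n) / Γ(c); this ratio removes the
  -- surplus.
  have h3 : Tendsto (fun n : ℕ => (b + n) / (a + n)) atTop (𝓝 1) := by
    simpa [add_comm] using tendsto_add_mul_div_add_mul_atTop_nhds b a (1 : ℝ) one_ne_zero
  have h2 := ((key ha).div (key hb) one_ne_zero).mul h3
  simp only [div_one, mul_one] at h2
  refine h2.congr' ?_
  filter_upwards [eventually_gt_atTop 0] with n hn
  have hn' : (0 : ℝ) < n := Nat.cast_pos.2 hn
  have := Real.Gamma_pos_of_pos (show 0 < a + n by positivity)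
  have := Real.Gamma_pos_of_pos (show 0 < b + n by positivity)
  have : (0 : ℝ) < n.factorial := Nat.cast_pos.2 n.factorial_pos
  have : 0 < (n : ℝ) ^ a := Real.rpow_pos_of_pos hn' _
  have : 0 < (n : ℝ) ^ b := Real.rpow_pos_of_pos hn' _
  rw [Real.rpow_sub hn', Pi.div_apply]
  field_simp

/-- The Gamma ratio is taken along n = K s + j, and (K / n)^(1-d) tends to s^(d-1). -/
theorem tendsto_betaRate_mul_rpow (hd1 : d < 1) (hα : -d < α) (hs : 1 ≤ s) (j : ℕ) :
    Tendsto (fun K : ℕ => betaRate γ α d (K * s + j) * (K : ℝ) ^ (1 - d)) atTop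
      (𝓝 (γ * (Real.Gamma (α + 1) / Real.Gamma (α + d)) * (s : ℝ) ^ (d - 1))) := by
  have hs' : (0 : ℝ) < s := Nat.cast_pos.2 hs
  have hlim : Tendsto (fun K : ℕ => K * s + j) atTop atTop :=
    tendsto_atTop_mono (fun K => show K ≤ K * s + j by nlinarith) tendsto_id
  have h1 := (tendsto_Gamma_add_natCast_div (show 0 < α + d by linarith)
    (show 0 < α + 1 by linarith)).comp hlim
  have h2 : Tendsto (fun K : ℕ => (K : ℝ) / ((K * s + j : ℕ) : ℝ)) atTop (𝓝 ((s : ℝ)⁻¹)) := by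
    have := tendsto_add_mul_div_add_mul_atTop_nhds (0 : ℝ) j 1 hs'.ne'
    refine (this.congr fun K => ?_).trans (by simp)
    push_cast
    ring_nf
  have h3 := h2.rpow_const (p := 1 - d) (Or.inl (by positivity))
  have h4 := (h1.mul h3).const_mul (γ * (Real.Gamma (α + 1) / Real.Gamma (α + d)))
  rw [one_mul, Real.inv_rpow hs'.le, ← Real.rpow_neg hs'.le, neg_sub] at h4
  refine h4.congr' ?_
  filter_upwards [eventually_gt_atTop 0] with K hK
  have hn : (0 : ℝ) < ((K * s + j : ℕ) : ℝ) := Nat.cast_pos.2 (by positivity)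
  have := Real.rpow_pos_of_pos hn (1 - d)
  rw [Real.div_rpow (by positivity) hn.le, betaRate, Function.comp_apply,
    show α + 1 - (α + d) = 1 - d by ring]
  field_simp

theorem isEquivalent_sum_betaRate (hγ : 0 < γ) (hd1 : d < 1) (hα : -d < α) (hs : 1 ≤ s) (N : ℕ) :
    Asymptotics.IsEquivalent atTop
      (fun K : ℕ => ∑ j ∈ Finset.range (N * s), betaRate γ α d (K * s + j))
      (fun K : ℕ => γ * N * (s : ℝ) ^ d * (Real.Gamma (α + 1) / Real.Gamma (α + d)) *
        (K : ℝ) ^ (d - 1)) := by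
  -- For N = 0 both functions vanish identically and the ratio criterion used below does not apply.
  rcases N.eq_zero_or_pos with rfl | hN
  · simp only [zero_mul, Finset.range_zero, Finset.sum_empty, Nat.cast_zero, mul_zero]
    rfl
  have hs' : (0 : ℝ) < s := Nat.cast_pos.2 hs
  have hN' : (0 : ℝ) < N := Nat.cast_pos.2 hN
  have h1 := Real.Gamma_pos_of_pos (show 0 < α + 1 by linarith)
  have h2 := Real.Gamma_pos_of_pos (show 0 < α + d by linarith)
  set L := γ * N * (s : ℝ) ^ d * (Real.Gamma (α + 1) / Real.Gamma (α + d)) with hL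
  have hL0 : 0 < L := by have := Real.rpow_pos_of_pos hs' d; positivity
  rw [Asymptotics.isEquivalent_iff_tendsto_one]
  · have h3 := (tendsto_finsetSum (Finset.range (N * s)) fun j _ =>
      tendsto_betaRate_mul_rpow (γ := γ) hd1 hα hs j).div_const L
    -- N s equal limits, with s · s^(d-1) = s^d.
    have h4 : (∑ _j ∈ Finset.range (N * s),
        γ * (Real.Gamma (α + 1) / Real.Gamma (α + d)) * (s : ℝ) ^ (d - 1)) / L = 1 := by
      rw [div_eq_one_iff_eq hL0.ne', Finset.sum_const, Finset.card_range, nsmul_eq_mul,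
        Real.rpow_sub_one hs'.ne', hL]
      push_cast
      field_simp
    rw [h4] at h3
    refine h3.congr' ?_
    filter_upwards [eventually_gt_atTop 0] with K hK
    have hK' : (0 : ℝ) < K := Nat.cast_pos.2 hK
    have := Real.rpow_pos_of_pos hK' (1 - d)
    rw [Pi.div_apply, ← Finset.sum_mul, ← neg_sub 1 d, Real.rpow_neg hK'.le]
    field_simp
  · filter_upwards [eventually_gt_atTop 0] with K hK
    have := Real.rpow_pos_of_pos (Nat.cast_pos.2 hK : (0 : ℝ) < K) (d - 1)
    positivity

end Rate

/-! ### Bernoulli likelihood: a single mark and beta weights. -/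

section Bernoulli

variable {γ α d : ℝ}

theorem sbRateAt_bernoulliLik_of_one_lt (ν : Measure ℝ) (k : ℕ) {x : ℕ} (hx : 1 < x) :
    sbRateAt ν bernoulliLik k x = 0 := by
  simp [sbRateAt, bernoulliLik, hx.not_ge]

theorem sbRate_bernoulliLik (ν : Measure ℝ) (k : ℕ) :
    sbRate ν bernoulliLik k = sbRateAt ν bernoulliLik k 1 :=
  tsum_eq_single 0 fun x hx => sbRateAt_bernoulliLik_of_one_lt ν k (by omega)

theorem sbRate_bernoulliLik_succ (hγ : 0 < γ) (hd1 : d < 1) (hα : -d < α) (j : ℕ) :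
    sbRate (betaProcessRate γ α d) bernoulliLik (j + 1) = ENNReal.ofReal (betaRate γ α d j) := by
  rw [sbRate_betaProcessRate isNatLikelihood_bernoulliLik bernoulliLik_zero hγ hd1 hα]
  simp

theorem sbWeightLaw_bernoulliLik (hγ : 0 < γ) (hd1 : d < 1) (hα : -d < α) (j : ℕ) :
    sbWeightLaw (betaProcessRate γ α d) bernoulliLik (j + 1) 1 =
      betaMeasure (1 - d) (α + d + j) := by
  have h1 : sbIntensity (betaProcessRate γ α d) bernoulliLik (j + 1) 1 =
      ENNReal.ofReal (betaRate γ α d j) • betaMeasure (1 - d) (α + d + j) := by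
    rw [← betaProcessRate_withDensity hγ hd1 hα]
    simp [sbIntensity, bernoulliLik]
  rw [sbWeightLaw, ← sbRate_bernoulliLik, sbRate_bernoulliLik_succ hγ hd1 hα, h1, smul_smul,
    ENNReal.inv_mul_cancel _ ENNReal.ofReal_ne_top, one_smul]
  simpa using betaRate_pos hγ hd1 hα j

theorem sbMarkWeightLaw_bernoulliLik (hγ : 0 < γ) (hd1 : d < 1) (hα : -d < α) (j : ℕ) :
    sbMarkWeightLaw (betaProcessRate γ α d) bernoulliLik (j + 1) =
      (betaMeasure (1 - d) (α + d + j)).map (fun t => (1, t)) := by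
  have hne : ENNReal.ofReal (betaRate γ α d j) ≠ 0 := by simpa using betaRate_pos hγ hd1 hα j
  ext S hS
  rw [sbMarkWeightLaw, Measure.sum_apply _ hS, tsum_eq_single 0]
  · rw [zero_add, sbWeightLaw_bernoulliLik hγ hd1 hα, ← sbRate_bernoulliLik,
      sbRate_bernoulliLik_succ hγ hd1 hα, ENNReal.div_self hne ENNReal.ofReal_ne_top, one_smul]
  · intro x hx
    rw [sbRateAt_bernoulliLik_of_one_lt _ _ (by omega)]
    simp

end Bernoulli

/-! ### Marginal laws, and representations with trivial marks. -/

section Rep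

variable {Ω Ψ : Type*} [MeasurableSpace Ω] [MeasurableSpace Ψ] {ν : Measure ℝ} {h : ℕ → ℝ → ℝ}
  {G : Measure Ψ} {P : Measure Ω} {C : ℕ → Ω → ℕ} {z : ℕ → ℕ → Ω → ℕ}
  {θ : ℕ → ℕ → Ω → ℝ} {ψ : ℕ → ℕ → Ω → Ψ}

namespace IsSizeBiasedRep

theorem measurable_atom (H : IsSizeBiasedRep ν h G P C z θ ψ) (p : ℕ × ℕ) :
    Measurable fun ω => ((z p.1 p.2 ω, θ p.1 p.2 ω), ψ p.1 p.2 ω) :=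
  ((H.measurable_mark _ _).prodMk (H.measurable_weight _ _)).prodMk (H.measurable_loc _ _)

variable [IsProbabilityMeasure G]

theorem law_markWeight (H : IsSizeBiasedRep ν h G P C z θ ψ) (j i : ℕ) :
    P.map (fun ω => (z j i ω, θ j i ω)) = sbMarkWeightLaw ν h (j + 1) := by
  have h1 := congrArg (Measure.map Prod.fst) (H.law_atom j i)
  rw [Measure.map_map measurable_fst (H.measurable_atom (j, i)), Measure.map_fst_prod,
    measure_univ, one_smul] at h1
  exact h1

theorem law_weight (H : IsSizeBiasedRep ν h G P C z θ ψ) (j i : ℕ) :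
    P.map (θ j i) = (sbMarkWeightLaw ν h (j + 1)).map Prod.snd := by
  rw [← H.law_markWeight j i, Measure.map_map measurable_snd
    ((H.measurable_mark j i).prodMk (H.measurable_weight j i))]
  rfl

theorem law_weight_of_mark_eq_one {W : Measure ℝ} (H : IsSizeBiasedRep ν h G P C z θ ψ) {j : ℕ}
    (hW : sbMarkWeightLaw ν h (j + 1) = W.map (fun t => (1, t))) (i : ℕ) :
    P.map (θ j i) = W := by
  rw [H.law_weight, hW, Measure.map_map measurable_snd (by fun_prop)]
  exact Measure.map_id

theorem ae_mark_eq_one {W : Measure ℝ} (H : IsSizeBiasedRep ν h G P C z θ ψ) {j : ℕ}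
    (hW : sbMarkWeightLaw ν h (j + 1) = W.map (fun t => (1, t))) (i : ℕ) :
    ∀ᵐ ω ∂P, z j i ω = 1 := by
  have h1 : ∀ᵐ p ∂(P.map fun ω => (z j i ω, θ j i ω)), p.1 = 1 := by
    have hS : MeasurableSet {p : ℕ × ℝ | p.1 = 1} := measurable_fst (measurableSet_singleton 1)
    rw [H.law_markWeight, hW, ae_map_iff (by fun_prop) hS]
    simp
  exact ae_of_ae_map ((H.measurable_mark j i).prodMk (H.measurable_weight j i)).aemeasurable h1

end IsSizeBiasedRep

/-- One direction attaches the constant mark 1, the other forgets the marks; both are measurable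
maps applied atom by atom, so independence survives. -/
theorem isPoissonRounds_iff_exists_isSizeBiasedRep {r : ℕ → ℝ≥0} {W : ℕ → Measure ℝ}
    [SFinite G] [∀ j, SFinite (W (j + 1))] (hr : ∀ j, (sbRate ν h (j + 1)).toNNReal = r (j + 1))
    (hW : ∀ j, sbMarkWeightLaw ν h (j + 1) = (W (j + 1)).map (fun t => (1, t))) :
    IsPoissonRounds r W G P C θ ψ ↔ ∃ z, IsSizeBiasedRep ν h G P C z θ ψ := by
  constructor
  · intro H
    have hm (p : ℕ × ℕ) : Measurable fun ω => (θ p.1 p.2 ω, ψ p.1 p.2 ω) :=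
      (H.measurable_weight _ _).prodMk (H.measurable_loc _ _)
    refine ⟨fun _ _ _ => 1, H.measurable_count, fun _ _ => measurable_const, H.measurable_weight,
      H.measurable_loc, fun j => by rw [hr, H.law_count], fun j i => ?_, H.indep_count, ?_, ?_⟩
    · have h1 := congrArg (Measure.map fun p : ℝ × Ψ => (((1 : ℕ), p.1), p.2)) (H.law_atom j i)
      rw [Measure.map_map (by fun_prop) (hm (j, i))] at h1
      refine h1.trans ?_
      have h2 := Measure.map_prod_map (W (j + 1)) G (f := fun t => ((1 : ℕ), t)) (g := id)
        (by fun_prop) measurable_id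
      rw [Measure.map_id] at h2
      rw [hW, h2]
      rfl
    · exact H.indep_atom.comp (fun _ p => (((1 : ℕ), p.1), p.2)) fun _ => by fun_prop
    · exact H.indep_count_atom.comp (φ := id)
        (ψ := fun F p => (((1 : ℕ), (F p).1), (F p).2)) measurable_id (by fun_prop)
  · rintro ⟨z, H⟩
    refine ⟨H.measurable_count, H.measurable_weight, H.measurable_loc,
      fun j => by rw [← hr, H.law_count], fun j i => ?_, H.indep_count, ?_, ?_⟩
    · have h1 := congrArg (Measure.map fun p : (ℕ × ℝ) × Ψ => (p.1.2, p.2)) (H.law_atom j i)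
      rw [Measure.map_map (by fun_prop) (H.measurable_atom (j, i)), hW] at h1
      refine h1.trans ?_
      have h2 := Measure.map_prod_map ((W (j + 1)).map fun t => ((1 : ℕ), t)) G (f := Prod.snd)
        (g := id) measurable_snd measurable_id
      rw [Measure.map_id, Measure.map_map measurable_snd (by fun_prop)] at h2
      refine h2.symm.trans ?_
      congr 1
      exact Measure.map_id
    · exact H.indep_atom.comp (fun _ p => (p.1.2, p.2)) fun _ => by fun_prop
    · exact H.indep_count_atom.comp (φ := id)
        (ψ := fun F p => ((F p).1.2, (F p).2)) measurable_id (by fun_prop)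

end Rep

/-! ### Poisson generating function, coupling inequality and finite index sets. -/

theorem lintegral_pow_poissonMeasure (r : ℝ≥0) {p : ℝ≥0∞} (hp : p ≠ ∞) :
    ∫⁻ n, p ^ n ∂(poissonMeasure r) = ENNReal.ofReal (Real.exp (r * p.toReal - r)) := by
  set q := p.toReal with hq
  have hq0 : 0 ≤ q := ENNReal.toReal_nonneg
  have hpq : p = ENNReal.ofReal q := (ENNReal.ofReal_toReal hp).symm
  have h1 : HasSum (fun n : ℕ => Real.exp (-r) * r ^ n / n.factorial * q ^ n)
      (Real.exp (r * q - r)) := by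
    have := (NormedSpace.expSeries_div_hasSum_exp (r * q : ℝ)).mul_left (Real.exp (-r))
    rw [← Real.exp_eq_exp_ℝ, ← Real.exp_add, neg_add_eq_sub] at this
    refine this.congr_fun fun n => ?_
    rw [mul_pow]; ring
  rw [poissonMeasure, lintegral_sum_measure, ← h1.tsum_eq,
    ENNReal.ofReal_tsum_of_nonneg (fun n => by positivity) h1.summable]
  refine tsum_congr fun n => ?_
  rw [lintegral_smul_measure, lintegral_dirac, smul_eq_mul, hpq, ENNReal.ofReal_mul (by positivity),
    ENNReal.ofReal_pow hq0]

/-- The integrals differ only on E, where both integrands lie in [0, 1]. Only E has to be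
measurable, so the measurability of the data probabilities in ω is never needed. -/
theorem abs_toReal_lintegral_sub_le {Ω : Type*} [MeasurableSpace Ω] {P : Measure Ω}
    [IsProbabilityMeasure P] {f g : Ω → ℝ≥0∞} {E : Set Ω} (hE : MeasurableSet E)
    (hf : ∀ ω, f ω ≤ 1) (hg : ∀ ω, g ω ≤ 1) (hfg : ∀ ω ∈ Eᶜ, f ω = g ω) :
    |(∫⁻ ω, f ω ∂P).toReal - (∫⁻ ω, g ω ∂P).toReal| ≤ (P E).toReal := by
  have key {f g : Ω → ℝ≥0∞} (hf : ∀ ω, f ω ≤ 1) (hg : ∀ ω, g ω ≤ 1)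
      (hfg : ∀ ω ∈ Eᶜ, f ω = g ω) :
      (∫⁻ ω, f ω ∂P).toReal ≤ (P E).toReal + (∫⁻ ω, g ω ∂P).toReal := by
    have hg' : ∫⁻ ω, g ω ∂P ≠ ∞ :=
      ((lintegral_mono hg).trans_lt (by simp)).ne
    rw [← ENNReal.toReal_add (measure_ne_top _ _) hg']
    refine ENNReal.toReal_mono (by simp [hg']) ?_
    rw [← lintegral_add_compl f hE, setLIntegral_congr_fun hE.compl hfg]
    gcongr
    · exact (lintegral_mono hf).trans (by simp)
    · exact Measure.restrict_le_self
  rw [abs_sub_le_iff]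
  exact ⟨by linarith [key hf hg hfg], by linarith [key hg hf fun ω hω => (hfg ω hω).symm]⟩

/-- The pairs `(j, i)` with `j ∈ s` and `i < c j`. -/
def roundPairs (s : Finset ℕ) (c : ℕ → ℕ) : Finset (ℕ × ℕ) :=
  (s.sigma fun j => Finset.range (c j)).map (Equiv.sigmaEquivProd ℕ ℕ).toEmbedding

theorem mem_roundPairs {s : Finset ℕ} {c : ℕ → ℕ} {p : ℕ × ℕ} :
    p ∈ roundPairs s c ↔ p.1 ∈ s ∧ p.2 < c p.1 := by
  simp [roundPairs, Equiv.sigmaEquivProd]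

theorem prod_roundPairs {M : Type*} [CommMonoid M] (s : Finset ℕ) (c : ℕ → ℕ) (f : ℕ × ℕ → M) :
    ∏ p ∈ roundPairs s c, f p = ∏ j ∈ s, ∏ i ∈ Finset.range (c j), f (j, i) := by
  rw [roundPairs, Finset.prod_map, Finset.prod_sigma]
  rfl

/-! ### Weight law and truncation bound of a single round. -/

section Law

variable {ν : Measure ℝ} {h : ℕ → ℝ → ℝ}

/-- Once the mark is forgotten, the probability η_{kx} / η_k cancels the normalization η_{kx}⁻¹ of
the conditional weight law. -/
theorem map_snd_sbMarkWeightLaw (hh : IsNatLikelihood h) (hν : ∀ᵐ t ∂ν, t ∈ Set.Ioo (0 : ℝ) 1)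
    {k : ℕ} (hk : sbRate ν h k ≠ ∞) :
    (sbMarkWeightLaw ν h k).map Prod.snd =
      (sbRate ν h k)⁻¹ • ν.withDensity fun t => ENNReal.ofReal (h 0 t ^ (k - 1) * (1 - h 0 t)) := by
  have hm := hh.measurable
  have h1 (x : ℕ) : sbRateAt ν h k (x + 1) • sbWeightLaw ν h k (x + 1) =
      sbIntensity ν h k (x + 1) := by
    rw [sbWeightLaw, smul_smul]
    -- If η_{kx} = 0 then η_{kx} η_{kx}⁻¹ = 0 rather than 1, but the intensity is then the zero
    -- measure.
    by_cases h0 : sbRateAt ν h k (x + 1) = 0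
    · rw [h0, zero_mul, zero_smul, eq_comm, ← Measure.measure_univ_eq_zero, sbIntensity,
        withDensity_apply _ MeasurableSet.univ, setLIntegral_univ]
      exact h0
    · rw [ENNReal.mul_inv_cancel h0, one_smul]
      exact ne_top_of_le_ne_top hk (ENNReal.le_tsum x)
  have h2 : (ν.withDensity fun t => ENNReal.ofReal (h 0 t ^ (k - 1) * (1 - h 0 t))) =
      Measure.sum fun x : ℕ => sbIntensity ν h k (x + 1) := by
    simp only [sbIntensity]
    rw [← withDensity_tsum fun x => by fun_prop]
    refine withDensity_congr_ae ?_
    filter_upwards [hν] with t ht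
    rw [ENNReal.tsum_apply, hh.tsum_succ_mul ht]
  rw [h2, sbMarkWeightLaw, Measure.map_sum (by fun_prop)]
  ext S hS
  rw [Measure.sum_apply _ hS, Measure.smul_apply, Measure.sum_apply _ hS, smul_eq_mul,
    ← ENNReal.tsum_mul_left]
  refine tsum_congr fun x => ?_
  rw [Measure.map_smul, Measure.map_map measurable_snd (by fun_prop), ← h1]
  change _ * (Measure.map id _) S = _
  rw [Measure.map_id, Measure.smul_apply, smul_eq_mul, div_eq_mul_inv]
  ring

/-- The part of the truncation bound that comes from one round. -/
noncomputable def sbRoundBound (ν : Measure ℝ) (h : ℕ → ℝ → ℝ) (N k : ℕ) : ℝ≥0∞ :=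
  ∫⁻ t, ENNReal.ofReal ((1 - h 0 t ^ N) * (h 0 t ^ (k - 1) * (1 - h 0 t))) ∂ν

/-- A finite geometric sum: ∑_{K≤j<J} π^j (1 - π) ≤ π^K. -/
theorem sum_sbRoundBound_le (hh : IsNatLikelihood h) (hν : ∀ᵐ t ∂ν, t ∈ Set.Ioo (0 : ℝ) 1)
    (N K J : ℕ) :
    ∑ j ∈ Finset.Ico K J, sbRoundBound ν h N (j + 1) ≤ sbTruncBound ν h N K := by
  have hm := hh.measurable
  simp only [sbRoundBound]
  rw [sbTruncBound_eq_lintegral hh hν, ← lintegral_finsetSum _ fun j _ => by fun_prop]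
  refine lintegral_mono_ae ?_
  filter_upwards [hν] with t ht
  have h0 := hh.nonneg 0 t ht
  have h1 : 0 ≤ 1 - h 0 t := by linarith [hh.zero_lt_one t ht]
  have h2 : 0 ≤ 1 - h 0 t ^ N := sub_nonneg.2 (pow_le_one₀ h0 (by linarith))
  rw [← ENNReal.ofReal_sum_of_nonneg fun j _ => by positivity]
  refine ENNReal.ofReal_le_ofReal ?_
  rw [← Finset.mul_sum, ← Finset.sum_mul, mul_comm]
  refine mul_le_mul_of_nonneg_right ?_ h2
  simp only [Nat.add_sub_cancel]
  rw [Finset.sum_Ico_eq_sum_range]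
  simp only [pow_add]
  rw [← Finset.mul_sum, mul_assoc, geom_sum_mul_neg]
  exact mul_le_of_le_one_right (by positivity) (by simp; positivity)

theorem lintegral_add_sbRoundBound (hh : IsNatLikelihood h)
    (hν : ∀ᵐ t ∂ν, t ∈ Set.Ioo (0 : ℝ) 1) (N k : ℕ) :
    (∫⁻ t, ENNReal.ofReal (h 0 t) ^ N * ENNReal.ofReal (h 0 t ^ (k - 1) * (1 - h 0 t)) ∂ν) +
      sbRoundBound ν h N k = sbRate ν h k := by
  have hm := hh.measurable
  rw [sbRoundBound, ← lintegral_add_left (by fun_prop), sbRate_eq_lintegral hh hν]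
  refine lintegral_congr_ae ?_
  filter_upwards [hν] with t ht
  have h0 := hh.nonneg 0 t ht
  have h1 : 0 ≤ 1 - h 0 t := by linarith [hh.zero_lt_one t ht]
  have h2 : 0 ≤ 1 - h 0 t ^ N := sub_nonneg.2 (pow_le_one₀ h0 (by linarith))
  rw [← ENNReal.ofReal_pow h0, ← ENNReal.ofReal_mul (by positivity),
    ← ENNReal.ofReal_add (by positivity) (by positivity)]
  congr 1
  ring

end Law

/-! ### No-atom probability and the truncation error. -/

section TotalVariation

variable {Ω Ψ : Type*} [MeasurableSpace Ω] [MeasurableSpace Ψ] {ν : Measure ℝ} {h : ℕ → ℝ → ℝ}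
  {G : Measure Ψ} {P : Measure Ω}
  {C : ℕ → Ω → ℕ} {z : ℕ → ℕ → Ω → ℕ} {θ : ℕ → ℕ → Ω → ℝ} {ψ : ℕ → ℕ → Ω → Ψ}
  {x : ℕ → ℕ → ℕ → Ω → ℕ}

/-- The event that the first `N` observations have no atoms in the rounds `j ∈ s`. -/
def noAtoms (C : ℕ → Ω → ℕ) (x : ℕ → ℕ → ℕ → Ω → ℕ) (N : ℕ) (s : Finset ℕ) : Set Ω :=
  {ω | ∀ n < N, ∀ j ∈ s, ∀ i < C j ω, x n j i ω = 0}

theorem measurableSet_noAtoms (hC : ∀ j, Measurable (C j)) (hx : ∀ n j i, Measurable (x n j i))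
    (N : ℕ) (s : Finset ℕ) : MeasurableSet (noAtoms C x N s) := by
  have : noAtoms C x N s =
      ⋂ n, ⋂ j, ⋂ i, {ω | n < N → j ∈ s → i < C j ω → x n j i ω = 0} := by
    ext ω
    simp only [noAtoms, Set.mem_ofPred_eq, Set.mem_iInter]
    exact ⟨fun H n j i hn hj => H n hn j hj i, fun H n hn j hj i => H n j i hn hj⟩
  rw [this]
  refine .iInter fun n => .iInter fun j => .iInter fun i => ?_
  have h1 : MeasurableSet {ω | i < C j ω} := measurableSet_lt measurable_const (hC j)
  have h2 : MeasurableSet {ω | x n j i ω = 0} := hx n j i (measurableSet_singleton 0)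
  simp only [imp_iff_not_or, Set.ofPred_or]
  exact (MeasurableSet.const _).union ((MeasurableSet.const _).union (h1.compl.union h2))

/-- The conditional law covers fixed finite families of trait counts, whereas the atoms present are
random in number. Partitioning by the values of the first J counts makes the index set deterministic
on each piece. -/
theorem measure_noAtoms_eq_lintegral (H : IsSizeBiasedRep ν h G P C z θ ψ)
    (L : IsLikelihoodField h P C z θ ψ x) (N K J : ℕ) :
    P (noAtoms C x N (Finset.Ico K J)) =
      ∫⁻ ω, ∏ j ∈ Finset.Ico K J, ∏ i ∈ Finset.range (C j ω),
        ENNReal.ofReal (h 0 (θ j i ω)) ^ N ∂P := by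
  set B : (Fin J → ℕ) → Set Ω := fun c => {ω | ∀ j : Fin J, C j ω = c j} with hB
  have hBm (c : Fin J → ℕ) : MeasurableSet (B c) := by
    simp only [hB, Set.ofPred_forall]
    exact .iInter fun j => H.measurable_count j (measurableSet_singleton _)
  have hBd : Pairwise (Function.onFun Disjoint B) := fun c c' hc =>
    Set.disjoint_left.2 fun ω h1 h2 => hc (funext fun j => (h1 j).symm.trans (h2 j))
  have hBu : ⋃ c, B c = Set.univ := Set.eq_univ_of_forall fun ω =>
    Set.mem_iUnion.2 ⟨fun j => C j ω, fun _ => rfl⟩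
  rw [← setLIntegral_univ, ← hBu, lintegral_iUnion hBm hBd,
    ← Set.univ_inter (noAtoms C x N _), ← hBu, Set.iUnion_inter,
    measure_iUnion (fun c c' hc => (hBd hc).mono Set.inter_subset_left Set.inter_subset_left)
      fun c => (hBm c).inter (measurableSet_noAtoms H.measurable_count L.measurable_obs N _)]
  refine tsum_congr fun c => ?_
  set c' : ℕ → ℕ := fun j => if hj : j < J then c ⟨j, hj⟩ else 0 with hc'
  have hCc {ω : Ω} (hω : ω ∈ B c) {j : ℕ} (hj : j ∈ Finset.Ico K J) : C j ω = c' j := by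
    have hj' : j < J := (Finset.mem_Ico.1 hj).2
    simpa [hc', hj'] using hω ⟨j, hj'⟩
  have hS : MeasurableSet {q : (ℕ → ℕ) × (ℕ × ℕ → (ℕ × ℝ) × Ψ) | ∀ j : Fin J, q.1 j = c j} := by
    simp only [Set.ofPred_forall]
    exact .iInter fun j => ((measurable_pi_apply _).comp measurable_fst) (measurableSet_singleton _)
  have key := L.cond_law _ hS (Finset.range N ×ˢ roundPairs (Finset.Ico K J) c') fun _ => 0
  have h1 : B c ∩ noAtoms C x N (Finset.Ico K J) = B c ∩
      {ω | ∀ p ∈ Finset.range N ×ˢ roundPairs (Finset.Ico K J) c', x p.1 p.2.1 p.2.2 ω = 0} := by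
    ext ω
    simp only [Set.mem_inter_iff, and_congr_right_iff, noAtoms, Set.mem_ofPred_eq,
      Finset.mem_product, Finset.mem_range, mem_roundPairs, Prod.forall]
    intro hω
    exact ⟨fun H n j i hp => H n hp.1 j hp.2.1 i (by rw [hCc hω hp.2.1]; exact hp.2.2),
      fun H n hn j hj i hi => H n j i ⟨hn, hj, by rwa [← hCc hω hj]⟩⟩
  rw [h1]
  refine key.trans (setLIntegral_congr_fun (hBm c) fun ω hω => ?_)
  rw [Finset.prod_product]
  dsimp only
  rw [Finset.prod_const, Finset.card_range, prod_roundPairs, ← Finset.prod_pow]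
  refine Finset.prod_congr rfl fun j hj => ?_
  rw [← hCc hω hj, Finset.prod_pow]

/-- Fubini for the product law of counts and atoms: with the counts fixed, independent atoms give ∏
p_j^(c_j), and independent counts then factor the outer integral. -/
theorem lintegral_prod_rounds [IsProbabilityMeasure P] (H : IsSizeBiasedRep ν h G P C z θ ψ) {φ : ℝ → ℝ≥0∞}
    (hφ : Measurable φ) {p : ℕ → ℝ≥0∞} (hp : ∀ j i, ∫⁻ ω, φ (θ j i ω) ∂P = p j) (s : Finset ℕ) :
    ∫⁻ ω, ∏ j ∈ s, ∏ i ∈ Finset.range (C j ω), φ (θ j i ω) ∂P =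
      ∏ j ∈ s, ∫⁻ n, p j ^ n ∂(poissonMeasure (sbRate ν h (j + 1)).toNNReal) := by
  set a : Ω → ℕ × ℕ → (ℕ × ℝ) × Ψ := fun ω q => ((z q.1 q.2 ω, θ q.1 q.2 ω), ψ q.1 q.2 ω) with ha
  have ham : Measurable a := measurable_pi_lambda _ H.measurable_atom
  have hCm : Measurable fun ω j => C j ω := measurable_pi_lambda _ H.measurable_count
  have hmeas : Measurable fun q : (ℕ → ℕ) × (ℕ × ℕ → (ℕ × ℝ) × Ψ) =>
      ∏ j ∈ s, ∏ i ∈ Finset.range (q.1 j), φ (q.2 (j, i)).1.2 := by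
    refine Finset.measurable_prod _ fun j _ => ?_
    -- The product has random length, so measurability is checked for each of the countably many
    -- lengths.
    have h1 : Measurable fun q : ℕ × (ℕ × ℕ → (ℕ × ℝ) × Ψ) =>
        ∏ i ∈ Finset.range q.1, φ (q.2 (j, i)).1.2 :=
      measurable_from_prod_countable_right fun n => by dsimp only; fun_prop
    exact h1.comp (f := fun q : (ℕ → ℕ) × (ℕ × ℕ → (ℕ × ℝ) × Ψ) => (q.1 j, q.2)) (by fun_prop)
  have hlaw : P.map (fun ω => ((fun j => C j ω), a ω)) =
      (P.map fun ω j => C j ω).prod (P.map a) :=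
    (indepFun_iff_map_prod_eq_prod_map_map hCm.aemeasurable ham.aemeasurable).1 H.indep_count_atom
  have : IsProbabilityMeasure (P.map a) := Measure.isProbabilityMeasure_map ham.aemeasurable
  have hinner (c : ℕ → ℕ) : ∫⁻ b, ∏ j ∈ s, ∏ i ∈ Finset.range (c j), φ (b (j, i)).1.2 ∂(P.map a) =
      ∏ j ∈ s, p j ^ c j := by
    have hc : Measurable fun b : ℕ × ℕ → (ℕ × ℝ) × Ψ =>
        ∏ j ∈ s, ∏ i ∈ Finset.range (c j), φ (b (j, i)).1.2 := by fun_prop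
    rw [lintegral_map hc ham]
    have h1 := lintegral_prod_eq_prod_lintegral_of_indepFun (roundPairs s c)
      (fun q ω => φ (θ q.1 q.2 ω))
      (H.indep_atom.comp (fun _ b => φ b.1.2) fun _ => hφ.comp (by fun_prop))
      fun q => hφ.comp (H.measurable_weight _ _)
    simp only [prod_roundPairs, hp, Finset.prod_const, Finset.card_range] at h1
    exact h1
  calc _ = ∫⁻ q, ∏ j ∈ s, ∏ i ∈ Finset.range (q.1 j), φ (q.2 (j, i)).1.2
          ∂(P.map (fun ω => ((fun j => C j ω), a ω))) := by
        rw [lintegral_map hmeas (hCm.prodMk ham)]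
    _ = ∫⁻ c, ∏ j ∈ s, p j ^ c j ∂(P.map fun ω j => C j ω) := by
        rw [hlaw, lintegral_prod _ hmeas.aemeasurable]
        simp only [hinner]
    _ = ∫⁻ ω, ∏ j ∈ s, p j ^ C j ω ∂P := by
        rw [lintegral_map _ hCm]
        exact Finset.measurable_prod _ fun j _ =>
          (measurable_of_countable fun n : ℕ => p j ^ n).comp (measurable_pi_apply j)
    _ = _ := by
        have h1 := lintegral_prod_eq_prod_lintegral_of_indepFun s (fun j ω => p j ^ C j ω)
          (H.indep_count.comp (fun j n => p j ^ n) fun _ => measurable_of_countable _)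
          fun j => (measurable_of_countable fun n : ℕ => p j ^ n).comp (H.measurable_count j)
        rw [h1]
        refine Finset.prod_congr rfl fun j _ => ?_
        rw [← H.law_count j, lintegral_map (measurable_of_countable _) (H.measurable_count j)]

theorem exp_neg_le_measure_noAtoms [IsProbabilityMeasure P] [IsProbabilityMeasure G]
    (hh : IsNatLikelihood h)
    (hν : ∀ᵐ t ∂ν, t ∈ Set.Ioo (0 : ℝ) 1) (hr0 : ∀ k, sbRate ν h k ≠ 0)
    (hrt : ∀ k, sbRate ν h k ≠ ∞) (H : IsSizeBiasedRep ν h G P C z θ ψ)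
    (L : IsLikelihoodField h P C z θ ψ x) (N K J : ℕ) :
    ENNReal.ofReal (Real.exp (-(sbTruncBound ν h N K).toReal)) ≤
      P (noAtoms C x N (Finset.Ico K J)) := by
  have hm := hh.measurable
  have hφ : Measurable fun t => ENNReal.ofReal (h 0 t) ^ N := by fun_prop
  set I : ℕ → ℝ≥0∞ := fun j =>
    ∫⁻ t, ENNReal.ofReal (h 0 t) ^ N * ENNReal.ofReal (h 0 t ^ j * (1 - h 0 t)) ∂ν with hI
  have hadd (j : ℕ) : I j + sbRoundBound ν h N (j + 1) = sbRate ν h (j + 1) :=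
    lintegral_add_sbRoundBound hh hν N (j + 1)
  have hIt (j : ℕ) : I j ≠ ∞ := ne_top_of_le_ne_top (hrt (j + 1)) (hadd j ▸ le_self_add)
  have hbt (j : ℕ) : sbRoundBound ν h N (j + 1) ≠ ∞ :=
    ne_top_of_le_ne_top (hrt (j + 1)) (hadd j ▸ le_add_self)
  have hBt : sbTruncBound ν h N K ≠ ∞ := by
    rw [sbTruncBound_eq_sum hh hν]
    exact (ENNReal.sum_lt_top.2 fun n _ => (hrt _).lt_top).ne
  have hp (j i : ℕ) : ∫⁻ ω, ENNReal.ofReal (h 0 (θ j i ω)) ^ N ∂P =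
      (sbRate ν h (j + 1))⁻¹ * I j := by
    rw [← lintegral_map hφ (H.measurable_weight j i), H.law_weight,
      map_snd_sbMarkWeightLaw hh hν (hrt _), lintegral_smul_measure,
      lintegral_withDensity_eq_lintegral_mul _ (by fun_prop) hφ]
    simp only [hI, Nat.add_sub_cancel, Pi.mul_apply, smul_eq_mul, mul_comm]
  rw [measure_noAtoms_eq_lintegral H L, lintegral_prod_rounds H hφ hp]
  -- Here E[π(θ)^N] = I_j / η_{j+1}, so the Poisson exponent η_{j+1} (I_j / η_{j+1} - 1) is I_j -
  -- η_{j+1}, minus the round bound.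
  have hround (j : ℕ) : ∫⁻ n, ((sbRate ν h (j + 1))⁻¹ * I j) ^ n
      ∂(poissonMeasure (sbRate ν h (j + 1)).toNNReal) =
      ENNReal.ofReal (Real.exp (-(sbRoundBound ν h N (j + 1)).toReal)) := by
    rw [lintegral_pow_poissonMeasure _ (ENNReal.mul_ne_top (by simpa using hr0 _) (hIt j))]
    have h1 : 0 < (sbRate ν h (j + 1)).toReal := ENNReal.toReal_pos (hr0 _) (hrt _)
    have h2 := congrArg ENNReal.toReal (hadd j)
    rw [ENNReal.toReal_add (hIt j) (hbt j)] at h2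
    rw [ENNReal.coe_toNNReal_eq_toReal, ENNReal.toReal_mul, ENNReal.toReal_inv,
      mul_inv_cancel_left₀ h1.ne']
    congr 2
    linarith
  simp only [hround]
  rw [← ENNReal.ofReal_prod_of_nonneg fun j _ => (Real.exp_pos _).le, ← Real.exp_sum,
    Finset.sum_neg_distrib, ← ENNReal.toReal_sum fun j _ => hbt j]
  refine ENNReal.ofReal_le_ofReal (Real.exp_le_exp.2 (neg_le_neg ?_))
  exact ENNReal.toReal_mono hBt (sum_sbRoundBound_le hh hν N K J)

omit [MeasurableSpace Ω] in
theorem roundObs_eq_zero {y : ℕ → ℕ → Ω → ℕ} {j : ℕ} {ω : Ω} (hy : ∀ i < C j ω, y j i ω = 0) :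
    roundObs C ψ y j ω = 0 :=
  Finset.sum_eq_zero fun i hi => by simp [hy i (Finset.mem_range.1 hi)]

omit [MeasurableSpace Ω] in
theorem fullObs_eq_truncObs {y : ℕ → ℕ → Ω → ℕ} {K : ℕ} {ω : Ω}
    (hy : ∀ j, K ≤ j → ∀ i < C j ω, y j i ω = 0) :
    fullObs C ψ y ω = truncObs C ψ y K ω := by
  ext S hS
  rw [fullObs, truncObs, Measure.sum_apply _ hS, Measure.finsetSum_apply]
  refine tsum_eq_sum fun j hj => ?_
  rw [roundObs_eq_zero (hy j (by simpa using hj))]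
  rfl

/-- The truncation error bound for the size-biased representation. -/
theorem abs_dataProb_sub_le [IsProbabilityMeasure P] [IsProbabilityMeasure G]
    {𝒴 : Type*} [MeasurableSpace 𝒴] (hh : IsNatLikelihood h)
    (hν : ∀ᵐ t ∂ν, t ∈ Set.Ioo (0 : ℝ) 1) (hr0 : ∀ k, sbRate ν h k ≠ 0)
    (hrt : ∀ k, sbRate ν h k ≠ ∞) (f : Kernel (Measure Ψ) 𝒴) [IsMarkovKernel f]
    (H : IsSizeBiasedRep ν h G P C z θ ψ) (L : IsLikelihoodField h P C z θ ψ x) (N K : ℕ)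
    (A : Set (Fin N → 𝒴)) :
    |(dataProb P f (fun n : Fin N => fullObs C ψ (x n)) A).toReal -
      (dataProb P f (fun n : Fin N => truncObs C ψ (x n) K) A).toReal| ≤
      1 - Real.exp (-(sbTruncBound ν h N K).toReal) := by
  have hmeas (J : ℕ) := measurableSet_noAtoms H.measurable_count L.measurable_obs N (Finset.Ico K J)
  set E : Set Ω := ⋂ J, noAtoms C x N (Finset.Ico K J) with hE
  have hanti : Antitone fun J => noAtoms C x N (Finset.Ico K J) := fun J J' hJ ω hω n hn j hj =>
    hω n hn j (Finset.Ico_subset_Ico_right hJ hj)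
  -- The lower bound does not depend on J, so it passes to the decreasing intersection over J.
  have hPE : ENNReal.ofReal (Real.exp (-(sbTruncBound ν h N K).toReal)) ≤ P E :=
    ge_of_tendsto' (tendsto_measure_iInter_atTop (fun J => (hmeas J).nullMeasurableSet) hanti
      ⟨0, measure_ne_top _ _⟩) fun J => exp_neg_le_measure_noAtoms hh hν hr0 hrt H L N K J
  have hEm : MeasurableSet E := .iInter hmeas
  have h1 : (P Eᶜ).toReal ≤ 1 - Real.exp (-(sbTruncBound ν h N K).toReal) := by
    have := ENNReal.toReal_mono (measure_ne_top _ _) hPE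
    rw [ENNReal.toReal_ofReal (Real.exp_pos _).le] at this
    have h2 := probReal_compl_eq_one_sub (μ := P) hEm
    rw [measureReal_def, measureReal_def] at h2
    linarith
  refine (abs_toReal_lintegral_sub_le hEm.compl (fun ω => prob_le_one) (fun ω => prob_le_one)
    fun ω hω => ?_).trans h1
  rw [compl_compl] at hω
  have h2 (n : Fin N) : fullObs C ψ (x n) ω = truncObs C ψ (x n) K ω :=
    fullObs_eq_truncObs fun j hj i hi =>
      Set.mem_iInter.1 hω (j + 1) n n.2 j (Finset.mem_Ico.2 ⟨hj, j.lt_succ_self⟩) i hi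
  simp only [h2]

end TotalVariation

/-! ### Specialization to the beta process and assembly. -/

theorem sbRate_betaProcessRate_ne_zero {γ α d : ℝ} {h : ℕ → ℝ → ℝ} {s : ℕ}
    (hh : IsNatLikelihood h) (h0 : ∀ t, h 0 t = (1 - t) ^ s) (hs : 1 ≤ s) (hγ : 0 < γ)
    (hd1 : d < 1) (hα : -d < α) (k : ℕ) : sbRate (betaProcessRate γ α d) h k ≠ 0 := by
  rw [sbRate_betaProcessRate hh h0 hγ hd1 hα]
  simpa using Finset.sum_pos (fun j _ => betaRate_pos hγ hd1 hα _)
    (Finset.nonempty_range_iff.2 (by omega))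

theorem sbRate_betaProcessRate_ne_top {γ α d : ℝ} {h : ℕ → ℝ → ℝ} {s : ℕ}
    (hh : IsNatLikelihood h) (h0 : ∀ t, h 0 t = (1 - t) ^ s) (hγ : 0 < γ)
    (hd1 : d < 1) (hα : -d < α) (k : ℕ) : sbRate (betaProcessRate γ α d) h k ≠ ∞ := by
  rw [sbRate_betaProcessRate hh h0 hγ hd1 hα]
  exact ENNReal.ofReal_ne_top

theorem isPoissonRounds_iff_exists_isSizeBiasedRep_bernoulliLik {Ω Ψ : Type*} [MeasurableSpace Ω]
    [MeasurableSpace Ψ] {P : Measure Ω} {G : Measure Ψ} [IsProbabilityMeasure G] {γ α d : ℝ}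
    (hγ : 0 < γ) (hd1 : d < 1) (hα : -d < α) {r : ℕ → ℝ≥0} {W : ℕ → Measure ℝ}
    (hr : ∀ j, r (j + 1) = (betaRate γ α d j).toNNReal)
    (hW : ∀ j, W (j + 1) = betaMeasure (1 - d) (α + d + j)) (C : ℕ → Ω → ℕ)
    (θ : ℕ → ℕ → Ω → ℝ) (ψ : ℕ → ℕ → Ω → Ψ) :
    IsPoissonRounds r W G P C θ ψ ↔
      ∃ z, IsSizeBiasedRep (betaProcessRate γ α d) bernoulliLik G P C z θ ψ := by
  have hW' (j : ℕ) : SFinite (W (j + 1)) := by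
    have hj : (0 : ℝ) ≤ j := j.cast_nonneg
    have := isProbabilityMeasureBeta (show 0 < 1 - d by linarith)
      (show 0 < α + d + j by linarith)
    rw [hW]
    infer_instance
  refine isPoissonRounds_iff_exists_isSizeBiasedRep (fun j => ?_) fun j => ?_
  · rw [sbRate_bernoulliLik_succ hγ hd1 hα, hr]
    rfl
  · rw [sbMarkWeightLaw_bernoulliLik hγ hd1 hα, hW]

theorem sum_betaRate_nonneg {γ α d : ℝ} (hγ : 0 < γ) (hd1 : d < 1) (hα : -d < α) (n M : ℕ) :
    0 ≤ ∑ j ∈ Finset.range M, betaRate γ α d (n + j) :=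
  Finset.sum_nonneg fun _ _ => (betaRate_pos hγ hd1 hα _).le

theorem sum_betaRate_pos {γ α d : ℝ} (hγ : 0 < γ) (hd1 : d < 1) (hα : -d < α) (n : ℕ) {M : ℕ}
    (hM : 1 ≤ M) : 0 < ∑ j ∈ Finset.range M, betaRate γ α d (n + j) :=
  Finset.sum_pos (fun _ _ => betaRate_pos hγ hd1 hα _) (Finset.nonempty_range_iff.2 (by omega))

theorem mainTheorem2 {Ω Ψ 𝒴 : Type*} [MeasurableSpace Ω] [MeasurableSpace Ψ] [MeasurableSpace 𝒴]
    (P : Measure Ω) [IsProbabilityMeasure P] (G : Measure Ψ) [IsProbabilityMeasure G]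
    (γ α d : ℝ) (hγ : 0 < γ) (hd0 : 0 ≤ d) (hd1 : d < 1) (hα : -d < α) :
    -- Bernoulli likelihood: rates and weight laws
    (∀ k : ℕ, 1 ≤ k →
      sbRate (betaProcessRate γ α d) bernoulliLik k =
          sbRateAt (betaProcessRate γ α d) bernoulliLik k 1 ∧
      sbRate (betaProcessRate γ α d) bernoulliLik k =
          ∫⁻ t, ENNReal.ofReal (bernoulliLik 0 t ^ (k - 1) * (1 - bernoulliLik 0 t))
            ∂(betaProcessRate γ α d) ∧
      0 < γ * (Real.Gamma (α + 1) / Real.Gamma (α + d)) *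
          (Real.Gamma (α + d + k - 1) / Real.Gamma (α + k)) ∧
      sbRate (betaProcessRate γ α d) bernoulliLik k =
          ENNReal.ofReal (γ * (Real.Gamma (α + 1) / Real.Gamma (α + d)) *
            (Real.Gamma (α + d + k - 1) / Real.Gamma (α + k))) ∧
      (∀ x : ℕ, 1 < x → sbRateAt (betaProcessRate γ α d) bernoulliLik k x = 0) ∧
      sbWeightLaw (betaProcessRate γ α d) bernoulliLik k 1 =
          betaMeasure (1 - d) (α + d + k - 1)) ∧
    -- Bernoulli likelihood: all the rounds together have the rate measure of the beta process
    sbTail (betaProcessRate γ α d) bernoulliLik 0 = betaProcessRate γ α d ∧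
    -- Bernoulli likelihood: the marks are one and the weights have beta laws
    (∀ (C : ℕ → Ω → ℕ) (z : ℕ → ℕ → Ω → ℕ) (θ : ℕ → ℕ → Ω → ℝ) (ψ : ℕ → ℕ → Ω → Ψ),
      IsSizeBiasedRep (betaProcessRate γ α d) bernoulliLik G P C z θ ψ →
      ∀ j i, (∀ᵐ ω ∂P, z j i ω = 1) ∧
        P.map (θ j i) = betaMeasure (1 - d) (α + d + (j + 1 : ℕ) - 1)) ∧
    -- the explicit form of the representation, and the Thibaux–Jordan construction
    (∀ (C : ℕ → Ω → ℕ) (θ : ℕ → ℕ → Ω → ℝ) (ψ : ℕ → ℕ → Ω → Ψ),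
      (IsPoissonRounds
          (fun k => (γ * (Real.Gamma (α + 1) / Real.Gamma (α + d)) *
            (Real.Gamma (α + d + k - 1) / Real.Gamma (α + k))).toNNReal)
          (fun k => betaMeasure (1 - d) (α + d + k - 1)) G P C θ ψ ↔
        ∃ z, IsSizeBiasedRep (betaProcessRate γ α d) bernoulliLik G P C z θ ψ) ∧
      (d = 0 → (IsThibauxJordan γ α G P C θ ψ ↔
        ∃ z, IsSizeBiasedRep (betaProcessRate γ α 0) bernoulliLik G P C z θ ψ))) ∧
    -- Bernoulli likelihood: truncation error
    (∀ (C : ℕ → Ω → ℕ) (z : ℕ → ℕ → Ω → ℕ) (θ : ℕ → ℕ → Ω → ℝ) (ψ : ℕ → ℕ → Ω → Ψ)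
        (x : ℕ → ℕ → ℕ → Ω → ℕ) (f : Kernel (Measure Ψ) 𝒴) [IsMarkovKernel f],
      IsSizeBiasedRep (betaProcessRate γ α d) bernoulliLik G P C z θ ψ →
      IsLikelihoodField bernoulliLik P C z θ ψ x →
      ∀ (N K : ℕ) (A : Set (Fin N → 𝒴)), MeasurableSet A →
        |(dataProb P f (fun n : Fin N => fullObs C ψ (x n)) A).toReal -
          (dataProb P f (fun n : Fin N => truncObs C ψ (x n) K) A).toReal| ≤
        1 - Real.exp (-(sbTruncBound (betaProcessRate γ α d) bernoulliLik N K).toReal)) ∧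
    (∀ N K : ℕ,
      sbTruncBound (betaProcessRate γ α d) bernoulliLik N K =
        ∑ n ∈ Finset.Icc 1 N, sbRate (betaProcessRate γ α d) bernoulliLik (K + n)) ∧
    (0 < d → ∀ N : ℕ,
      (∀ K : ℕ,
        0 ≤ γ / d * (Real.Gamma (α + 1) / Real.Gamma (α + d)) *
          (Real.Gamma (α + d + K + N) / Real.Gamma (α + K + N) -
            Real.Gamma (α + d + K) / Real.Gamma (α + K)) ∧
        sbTruncBound (betaProcessRate γ α d) bernoulliLik N K =
          ENNReal.ofReal (γ / d * (Real.Gamma (α + 1) / Real.Gamma (α + d)) *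
            (Real.Gamma (α + d + K + N) / Real.Gamma (α + K + N) -
              Real.Gamma (α + d + K) / Real.Gamma (α + K)))) ∧
      Asymptotics.IsEquivalent atTop
        (fun K : ℕ => γ / d * (Real.Gamma (α + 1) / Real.Gamma (α + d)) *
          (Real.Gamma (α + d + K + N) / Real.Gamma (α + K + N) -
            Real.Gamma (α + d + K) / Real.Gamma (α + K)))
        (fun K : ℕ => γ * N * (Real.Gamma (α + 1) / Real.Gamma (α + d)) * (K : ℝ) ^ (d - 1))) ∧
    (d = 0 → ∀ N : ℕ,
      (∀ K : ℕ,
        0 ≤ γ * α * (realDigamma (α + N + K) - realDigamma (α + K)) ∧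
        sbTruncBound (betaProcessRate γ α 0) bernoulliLik N K =
          ENNReal.ofReal (γ * α * (realDigamma (α + N + K) - realDigamma (α + K)))) ∧
      Asymptotics.IsEquivalent atTop
        (fun K : ℕ => γ * α * (realDigamma (α + N + K) - realDigamma (α + K)))
        (fun K : ℕ => γ * α * N * (K : ℝ)⁻¹)) ∧
    -- negative binomial likelihood
    (∀ s : ℕ, 1 ≤ s →
      -- rates
      (∀ k : ℕ, 1 ≤ k →
        sbRate (betaProcessRate γ α d) (negBinLik s) k =
          ∫⁻ t, ENNReal.ofReal (negBinLik s 0 t ^ (k - 1) * (1 - negBinLik s 0 t))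
            ∂(betaProcessRate γ α d) ∧
        (0 < d →
          0 < γ / d * (Real.Gamma (α + 1) / Real.Gamma (α + d)) *
            (Real.Gamma (α + d + k * s) / Real.Gamma (α + k * s) -
              Real.Gamma (α + d + (k - 1) * s) / Real.Gamma (α + (k - 1) * s)) ∧
          sbRate (betaProcessRate γ α d) (negBinLik s) k =
            ENNReal.ofReal (γ / d * (Real.Gamma (α + 1) / Real.Gamma (α + d)) *
              (Real.Gamma (α + d + k * s) / Real.Gamma (α + k * s) -
                Real.Gamma (α + d + (k - 1) * s) / Real.Gamma (α + (k - 1) * s)))) ∧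
        (0 < α →
          0 < γ * α * (realDigamma (α + k * s) - realDigamma (α + (k - 1) * s)) ∧
          sbRate (betaProcessRate γ α 0) (negBinLik s) k =
            ENNReal.ofReal
              (γ * α * (realDigamma (α + k * s) - realDigamma (α + (k - 1) * s))) ∧
          Tendsto (fun δ : ℝ => sbRate (betaProcessRate γ α δ) (negBinLik s) k) (𝓝[>] 0)
            (𝓝 (ENNReal.ofReal
              (γ * α * (realDigamma (α + k * s) - realDigamma (α + (k - 1) * s))))))) ∧
      sbTail (betaProcessRate γ α d) (negBinLik s) 0 = betaProcessRate γ α d ∧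
      -- truncation error
      (∀ (C : ℕ → Ω → ℕ) (z : ℕ → ℕ → Ω → ℕ) (θ : ℕ → ℕ → Ω → ℝ) (ψ : ℕ → ℕ → Ω → Ψ)
          (x : ℕ → ℕ → ℕ → Ω → ℕ) (f : Kernel (Measure Ψ) 𝒴) [IsMarkovKernel f],
        IsSizeBiasedRep (betaProcessRate γ α d) (negBinLik s) G P C z θ ψ →
        IsLikelihoodField (negBinLik s) P C z θ ψ x →
        ∀ (N K : ℕ) (A : Set (Fin N → 𝒴)), MeasurableSet A →
          |(dataProb P f (fun n : Fin N => fullObs C ψ (x n)) A).toReal -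
            (dataProb P f (fun n : Fin N => truncObs C ψ (x n) K) A).toReal| ≤
          1 - Real.exp (-(sbTruncBound (betaProcessRate γ α d) (negBinLik s) N K).toReal)) ∧
      (∀ N K : ℕ,
        sbTruncBound (betaProcessRate γ α d) (negBinLik s) N K =
          ∑ n ∈ Finset.Icc 1 N, sbRate (betaProcessRate γ α d) (negBinLik s) (K + n)) ∧
      (0 < d → ∀ N : ℕ,
        (∀ K : ℕ,
          0 ≤ γ / d * (Real.Gamma (α + 1) / Real.Gamma (α + d)) *
            (Real.Gamma (α + d + (K + N) * s) / Real.Gamma (α + (K + N) * s) -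
              Real.Gamma (α + d + K * s) / Real.Gamma (α + K * s)) ∧
          sbTruncBound (betaProcessRate γ α d) (negBinLik s) N K =
            ENNReal.ofReal (γ / d * (Real.Gamma (α + 1) / Real.Gamma (α + d)) *
              (Real.Gamma (α + d + (K + N) * s) / Real.Gamma (α + (K + N) * s) -
                Real.Gamma (α + d + K * s) / Real.Gamma (α + K * s)))) ∧
        Asymptotics.IsEquivalent atTop
          (fun K : ℕ => γ / d * (Real.Gamma (α + 1) / Real.Gamma (α + d)) *
            (Real.Gamma (α + d + (K + N) * s) / Real.Gamma (α + (K + N) * s) -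
              Real.Gamma (α + d + K * s) / Real.Gamma (α + K * s)))
          (fun K : ℕ => γ * N * (s : ℝ) ^ d * (Real.Gamma (α + 1) / Real.Gamma (α + d)) *
            (K : ℝ) ^ (d - 1))) ∧
      (d = 0 → ∀ N : ℕ,
        (∀ K : ℕ,
          0 ≤ γ * α * (realDigamma (α + (K + N) * s) - realDigamma (α + K * s)) ∧
          sbTruncBound (betaProcessRate γ α 0) (negBinLik s) N K =
            ENNReal.ofReal
              (γ * α * (realDigamma (α + (K + N) * s) - realDigamma (α + K * s)))) ∧
        Asymptotics.IsEquivalent atTop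
          (fun K : ℕ => γ * α * (realDigamma (α + (K + N) * s) - realDigamma (α + K * s)))
          (fun K : ℕ => γ * α * N * (K : ℝ)⁻¹))) := by
  have hB := isNatLikelihood_bernoulliLik
  have hB0 := bernoulliLik_zero
  have hν := ae_mem_Ioo_betaProcessRate γ α d
  -- the closed form of the truncation bound for `π(t) = (1 - t) ^ s`
  have hdpos (hd : 0 < d) (s N K : ℕ) :
      γ / d * (Real.Gamma (α + 1) / Real.Gamma (α + d)) *
        (Real.Gamma (α + d + (K + N) * s) / Real.Gamma (α + (K + N) * s) -
          Real.Gamma (α + d + K * s) / Real.Gamma (α + K * s)) =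
        ∑ j ∈ Finset.range (N * s), betaRate γ α d (K * s + j) := by
    rw [sum_betaRate_of_pos hd hd1 hα]
    push_cast
    simp only [add_mul]
  have hdzero (hα0 : 0 < α) (s N K : ℕ) :
      γ * α * (realDigamma (α + (K + N) * s) - realDigamma (α + K * s)) =
        ∑ j ∈ Finset.range (N * s), betaRate γ α 0 (K * s + j) := by
    rw [sum_betaRate_zero hα0]
    push_cast
    simp only [add_mul]
  -- At d = 0 the constant loses its dependence on s, since s^0 = 1, and Γ(α + 1) / Γ(α) = α.
  have hequiv {s : ℕ} (hs : 1 ≤ s) (hα0 : 0 < α) (N : ℕ) : Asymptotics.IsEquivalent atTop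
      (fun K : ℕ => ∑ j ∈ Finset.range (N * s), betaRate γ α 0 (K * s + j))
      (fun K : ℕ => γ * α * N * (K : ℝ)⁻¹) := by
    have := isEquivalent_sum_betaRate (α := α) hγ zero_lt_one (by simpa) hs N
    have hG := (Real.Gamma_pos_of_pos hα0).ne'
    simp only [Real.rpow_zero, add_zero, zero_sub, Real.rpow_neg_one,
      Real.Gamma_add_one hα0.ne', mul_div_cancel_right₀ _ hG] at this
    refine this.congr_right (.of_forall fun K => ?_)
    ring
  have hbern (j : ℕ) : γ * (Real.Gamma (α + 1) / Real.Gamma (α + d)) *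
      (Real.Gamma (α + d + (j + 1 : ℕ) - 1) / Real.Gamma (α + (j + 1 : ℕ))) =
      betaRate γ α d j := by
    rw [betaRate]
    push_cast
    ring_nf
  have hbeta (j : ℕ) : betaMeasure (1 - d) (α + d + (j + 1 : ℕ) - 1) =
      betaMeasure (1 - d) (α + d + j) := by
    congr 1
    push_cast
    ring
  refine ⟨fun k hk => ?_, sbTail_zero hB hν, fun C z θ ψ H j i => ⟨?_, ?_⟩, fun C θ ψ => ⟨?_, ?_⟩,
    fun C z θ ψ x f _ H L N K A _ => ?_, fun N K => sbTruncBound_eq_sum hB hν N K,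
    fun hd N => ?_, ?_, fun s hs => ?_⟩
  · obtain ⟨j, rfl⟩ : ∃ j, k = j + 1 := ⟨k - 1, by omega⟩
    rw [hbern, hbeta]
    exact ⟨sbRate_bernoulliLik _ _, sbRate_eq_lintegral hB hν _, betaRate_pos hγ hd1 hα j,
      sbRate_bernoulliLik_succ hγ hd1 hα j,
      fun x hx => sbRateAt_bernoulliLik_of_one_lt _ _ hx, sbWeightLaw_bernoulliLik hγ hd1 hα j⟩
  · exact H.ae_mark_eq_one (sbMarkWeightLaw_bernoulliLik hγ hd1 hα j) i
  · rw [hbeta]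
    exact H.law_weight_of_mark_eq_one (sbMarkWeightLaw_bernoulliLik hγ hd1 hα j) i
  · exact isPoissonRounds_iff_exists_isSizeBiasedRep_bernoulliLik hγ hd1 hα
      (fun j => by rw [hbern]) hbeta C θ ψ
  · rintro rfl
    have hα0 : 0 < α := by simpa using hα
    refine isPoissonRounds_iff_exists_isSizeBiasedRep_bernoulliLik hγ hd1 hα (fun j => ?_)
      (fun j => ?_) C θ ψ
    · rw [betaRate_zero hα0]
      push_cast
      ring_nf
    · rw [sub_zero]
      congr 1
      push_cast
      ring
  · exact abs_dataProb_sub_le hB hν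
      (sbRate_betaProcessRate_ne_zero hB hB0 le_rfl hγ hd1 hα)
      (sbRate_betaProcessRate_ne_top hB hB0 hγ hd1 hα) f H L N K A
  · have e (K : ℕ) := hdpos hd 1 N K
    simp only [Nat.cast_one, mul_one, ← add_assoc] at e
    simp only [e]
    refine ⟨fun K => ⟨sum_betaRate_nonneg hγ hd1 hα K N, ?_⟩, ?_⟩
    · simpa using sbTruncBound_betaProcessRate hB hB0 hγ hd1 hα N K
    · simpa using isEquivalent_sum_betaRate hγ hd1 hα le_rfl N
  · rintro rfl N
    have hα0 : 0 < α := by simpa using hα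
    have e (K : ℕ) : γ * α * (realDigamma (α + N + K) - realDigamma (α + K)) =
        ∑ j ∈ Finset.range N, betaRate γ α 0 (K + j) := by
      rw [sum_betaRate_zero hα0, ← add_assoc, add_right_comm]
    simp only [e]
    refine ⟨fun K => ⟨sum_betaRate_nonneg hγ hd1 hα K N, ?_⟩, ?_⟩
    · simpa using sbTruncBound_betaProcessRate hB hB0 hγ hd1 hα N K
    · simpa using hequiv le_rfl hα0 N
  have hL := isNatLikelihood_negBinLik hs
  have hL0 := negBinLik_zero s
  refine ⟨fun k hk => ⟨sbRate_eq_lintegral hL hν k, fun hd => ?_, fun hα0 => ?_⟩,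
    sbTail_zero hL hν, fun C z θ ψ x f _ H L N K A _ => ?_,
    fun N K => sbTruncBound_eq_sum hL hν N K, fun hd N => ?_, ?_⟩
  · have e := hdpos hd s 1 (k - 1)
    rw [Nat.cast_sub hk, Nat.cast_one, sub_add_cancel, one_mul] at e
    rw [e]
    exact ⟨sum_betaRate_pos hγ hd1 hα _ hs, sbRate_betaProcessRate hL hL0 hγ hd1 hα k⟩
  · have e := hdzero hα0 s 1 (k - 1)
    rw [Nat.cast_sub hk, Nat.cast_one, sub_add_cancel, one_mul] at e
    rw [e]
    refine ⟨sum_betaRate_pos hγ zero_lt_one (by simpa) _ hs,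
      sbRate_betaProcessRate hL hL0 hγ zero_lt_one (by simpa) k, ?_⟩
    have hlim := (ENNReal.continuous_ofReal.tendsto _).comp
      (tendsto_finsetSum (Finset.range s) fun j _ =>
        tendsto_betaRate_zero (γ := γ) hα0 ((k - 1) * s + j))
    refine (hlim.mono_left nhdsWithin_le_nhds).congr' ?_
    -- The rate formula requires δ < 1, which holds near 0; the finite sum then converges term by
    -- term.
    filter_upwards [Ioo_mem_nhdsGT (zero_lt_one' ℝ)] with δ hδ
    exact (sbRate_betaProcessRate hL hL0 hγ hδ.2 (by linarith [hδ.1]) k).symm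
  · exact abs_dataProb_sub_le hL hν
      (sbRate_betaProcessRate_ne_zero hL hL0 hs hγ hd1 hα)
      (sbRate_betaProcessRate_ne_top hL hL0 hγ hd1 hα) f H L N K A
  · simp only [hdpos hd]
    exact ⟨fun K => ⟨sum_betaRate_nonneg hγ hd1 hα _ _,
      sbTruncBound_betaProcessRate hL hL0 hγ hd1 hα N K⟩,
      isEquivalent_sum_betaRate hγ hd1 hα hs N⟩
  · rintro rfl N
    have hα0 : 0 < α := by simpa using hα
    simp only [hdzero hα0]
    exact ⟨fun K => ⟨sum_betaRate_nonneg hγ hd1 hα _ _,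
      sbTruncBound_betaProcessRate hL hL0 hγ hd1 hα N K⟩, hequiv hs hα0 N⟩
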